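/- Let $b\ge 2$ be an integer and $\omega_b:=e^{2\pi\sqrt{-1}/b}$. Write a positive integer $k$ in base $b$ as $k=\kappa_1b^{a_1-1}+\cdots+\kappa_vb^{a_v-1}$ with $0<\kappa_i\le b-1$ and $a_1>\cdots>a_v\ge 1$, and for an integer $\alpha\ge1$ put $\mu_\alpha(k):=a_1+\cdots+a_{\min(\alpha,v)}$. For $x\in[0,1)$ with $b$-adic expansion $x=\xi_1b^{-1}+\xi_2b^{-2}+\cdots$ (infinitely many $\xi_i$ different from $b-1$) let $\mathrm{wal}_k(x):=\omega_b^{\kappa_1\xi_{a_1}+\cdots+\kappa_v\xi_{a_v}}$, and let $\widehat f(k):=\int_0^1 f(x)\overline{\mathrm{wal}_k(x)}\,dx$. Let $H_\alpha$ be the space of functions $f\colon[0,1]\to\mathbb{R}$ such that $f^{(i)}$ is absolutely continuous for $i=0,\dots,\alpha-1$ and $f^{(\alpha)}\in L^2[0,1]$. Put $m_b:=2\sin(\pi/b)$, and $M_b:=2$ if $b$ is even, $M_b:=2\sin\bigl((b+1)\pi/(2b)\bigr)$ if $b$ is odd. Let $\alpha$ and $k$ be positive integers and let $1\le p,q\le\infty$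 with $1/p+1/q=1$. Then for all $f\in H_\alpha$, $$|\widehat f(k)|\le b^{-\mu_\alpha(k)}\,C_{b,\alpha,q}\,\|f\|_{p,\alpha},$$ where $$\|f\|_{p,\alpha}:=\left(\sum_{i=0}^{\alpha}\left|\int_0^1f^{(i)}(x)\,dx\right|^p+\int_0^1|f^{(\alpha)}(x)|^p\,dx\right)^{1/p}\in[0,\infty],$$ $$C_{b,\alpha,q}:=\left(\sum_{i=1}^{\alpha}\frac1{m_b^{iq}}\left(1+\frac{b\,m_b}{b-M_b}\right)^q+\frac1{m_b^{\alpha q}}\left(M_b+\frac{b\,m_b}{b-M_b}\right)^q\right)^{1/q}\quad\text{for } b>2,$$ $$C_{2,\alpha,q}:=\left(\sum_{i=1}^{\alpha}2^{-iq}+2^{-(\alpha-1)q}\right)^{1/q}.$$ For $p=\infty$ or $q=\infty$ these expressions are understood in the usual sense: the $\ell^p$ (resp. $\ell^q$) sum is replaced by the maximum of the terms, and $\bigl(\int_0^1|f^{(\alpha)}|^p\bigr)^{1/p}$ by the essential supremum of $|f^{(\alpha)}|$ on $[0,1]$. -/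

import Mathlib

open scoped ENNReal

noncomputable section

namespace WalshSobolev

/-- The coefficient of `b ^ j` in the `b`-adic expansion of the nonnegative integer `k`. -/
def natDigit (b k j : ℕ) : ℕ := (Nat.digits b k).getD j 0

/-- The list `[a₁, …, a_v]`, in decreasing order, of the positions of the nonzero digits in the
`b`-adic expansion `k = κ₁ b ^ (a₁ - 1) + ⋯ + κ_v b ^ (a_v - 1)`, `a₁ > ⋯ > a_v ≥ 1`.
It is empty for `k = 0`. -/
def positions (b k : ℕ) : List ℕ :=
  ((List.range (Nat.digits b k).length).reverse.filter (fun j => natDigit b k j ≠ 0)).map (· + 1)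

/-- `μ_α(k) = a₁ + ⋯ + a_{min(α, v)}`. -/
def mu (b α k : ℕ) : ℕ := ((positions b k).take α).sum

/-- The `b`-adic `k`-th Walsh function `wal_k(x) = ω_b ^ (κ₁ ξ_{a₁} + ⋯ + κ_v ξ_{a_v})` for
`x = ξ₁ b⁻¹ + ξ₂ b⁻² + ⋯` in `[0, 1)` and `ω_b = exp (2 π i / b)`. `Real.digits x b j` is
`ξ_{j+1} = ⌊x b ^ (j+1)⌋ mod b`; these are the digits of the expansion of `x` in which infinitely
many digits differ from `b - 1`. -/
def wal (b : ℕ) [NeZero b] (k : ℕ) (x : ℝ) : ℂ :=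
  Complex.exp (2 * Real.pi * Complex.I / b) ^
    (∑ j ∈ Finset.range (Nat.digits b k).length, natDigit b k j * (Real.digits x b j : ℕ))

/-- The `k`-th Walsh coefficient of `f`. -/
def walshCoeff (b : ℕ) [NeZero b] (f : ℝ → ℝ) (k : ℕ) : ℂ :=
  ∫ x in Set.Ico (0 : ℝ) 1, (f x : ℂ) * (starRingEnd ℂ) (wal b k x)

/-- The `i`-th derivative of `f` as a function on `[0, 1]` (one-sided at the end points). -/
def der (i : ℕ) (f : ℝ → ℝ) : ℝ → ℝ := iteratedDerivWithin i f (Set.Icc 0 1)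

/-- The Sobolev space of the functions `f` on `[0, 1]` for which `f, f', …, f^(α-1)` exist
everywhere and are absolutely continuous and `f^(α)`, which then exists almost everywhere, is in
`L²[0, 1]`. Only the values of `f` on `[0, 1]` matter. -/
def Sob (α : ℕ) : Set (ℝ → ℝ) :=
  {f | (∀ i, i + 1 < α → DifferentiableOn ℝ (der i f) (Set.Icc 0 1)) ∧
    (∀ i, i < α → AbsolutelyContinuousOnInterval (der i f) 0 1) ∧
    MeasureTheory.MemLp (der α f) 2 (MeasureTheory.volume.restrict (Set.Icc 0 1))}

/-- `‖f‖_{p,α} = (∑_{i=0}^α |∫₀¹ f^(i)|^p + ∫₀¹ |f^(α)|^p)^{1/p}` for `1 ≤ p < ∞`, with the usual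
modification (maximum and essential supremum) for `p = ∞`. The value is `∞` if `f^(α)` is not
in `L^p[0, 1]`. -/
def sobNorm (p : ℝ≥0∞) (α : ℕ) (f : ℝ → ℝ) : ℝ≥0∞ :=
  if p = ∞ then
    max ((Finset.range (α + 1)).sup fun i => ‖∫ x in (0 : ℝ)..1, der i f x‖ₑ)
      (essSup (fun x => ‖der α f x‖ₑ) (MeasureTheory.volume.restrict (Set.Icc 0 1)))
  else
    ((∑ i ∈ Finset.range (α + 1), ‖∫ x in (0 : ℝ)..1, der i f x‖ₑ ^ p.toReal) +
      ∫⁻ x in Set.Icc (0 : ℝ) 1, ‖der α f x‖ₑ ^ p.toReal) ^ (1 / p.toReal)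

/-- `m_b = 2 sin (π / b)`, the minimum of `|1 - ω_b ^ c|` over `1 ≤ c ≤ b - 1`. -/
def mConst (b : ℕ) : ℝ := 2 * Real.sin (Real.pi / b)

/-- `M_b`, the maximum of `|1 - ω_b ^ c|` over `1 ≤ c ≤ b - 1`. -/
def MConst (b : ℕ) : ℝ :=
  if Even b then 2 else 2 * Real.sin ((b + 1) * Real.pi / (2 * b))

/-- The constant `C_{b,α,q}` for `b > 2`; for `q = ∞` the sum is replaced by the maximum. -/
def boundConstNonDyadic (b α : ℕ) (q : ℝ≥0∞) : ℝ :=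
  if q = ∞ then
    max
      (⨆ i : Finset.Icc 1 α,
        1 / mConst b ^ (i : ℕ) * (1 + b * mConst b / (b - MConst b)))
      (1 / mConst b ^ α * (MConst b + b * mConst b / (b - MConst b)))
  else
    ((∑ i ∈ Finset.Icc 1 α,
        1 / mConst b ^ (i * q.toReal) *
          (1 + b * mConst b / (b - MConst b)) ^ q.toReal) +
      1 / mConst b ^ (α * q.toReal) *
        (MConst b + b * mConst b / (b - MConst b)) ^ q.toReal) ^ (1 / q.toReal)

/-- The constant `C_{2,α,q}`; for `q = ∞` the sum is replaced by the maximum. -/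
def boundConstDyadic (α : ℕ) (q : ℝ≥0∞) : ℝ :=
  if q = ∞ then
    max (⨆ i : Finset.Icc 1 α, (2 : ℝ) ^ (-((i : ℕ) : ℝ))) ((2 : ℝ) ^ (-((α : ℝ) - 1)))
  else
    ((∑ i ∈ Finset.Icc 1 α, (2 : ℝ) ^ (-((i : ℝ) * q.toReal))) +
      (2 : ℝ) ^ (-(((α : ℝ) - 1) * q.toReal))) ^ (1 / q.toReal)

/-- The constant `C_{b,α,q}` for every base `b ≥ 2`. -/
def boundConst (b α : ℕ) (q : ℝ≥0∞) : ℝ :=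
  if b = 2 then boundConstDyadic α q else boundConstNonDyadic b α q

end WalshSobolev

end

open MeasureTheory intervalIntegral

namespace WalshSobolev

/-! The conjugate of `wal_k` is a product of factors `ω ^ ⌊x / h⌋` with `h = b⁻ᵃ`, one for each
nonzero digit of `k` (`digitWave`). If `h` is the finest step and `φ` is continuous and
`h`-periodic, the primitive of `ω ^ ⌊t / h⌋ * φ` from `0` (`stepPrimitive`) is continuous,
`bh`-periodic and zero at the multiples of `bh`. The coarser factors are constant between these
multiples, so the primitive of the whole product is their product times `stepPrimitive`. An
integration by parts therefore has no boundary terms, removes the top nonzero digit, replaces `f` by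
`f'`, and gains a factor `h / |1 - ω| ≤ b⁻ᵃ / m_b` (`integral_mul_digitWave_succ`).

This is iterated in `norm_integral_digitWave_le`. If the derivatives run out, `φ` is bounded by its
sup norm (constant `T₂`). If the digits run out, each further integration by parts splits off a mean
`∫ f^(i)` (constant `T₁`) and costs at most `1 / m_b` (`norm_integral_mul_le_derivBound`). Hölder's
inequality then produces `C_{b,α,q}`.

The constants for `φ` must not grow with the number of steps; `StepFamily` isolates what is needed.
For `b = 2` the functions stay between `0` and twice their mean. For `b ≥ 3` the deviation from the
mean and its primitive are controlled together; the fixed point `devConst` of the resulting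
recursion is compared with the stated constants in `one_add_devConst_le`. -/

/-! ### Primitives of periodic functions with mean zero. -/

theorem norm_integral_le_half {g : ℝ → ℂ} (hg : Continuous g) {P x y : ℝ}
    (h0 : ∫ t in (0 : ℝ)..P, g t = 0) (hx : 0 ≤ x) (hxy : x ≤ y) (hy : y ≤ P) :
    ‖∫ t in x..y, g t‖ ≤ (∫ t in (0 : ℝ)..P, ‖g t‖) / 2 := by
  have hi : ∀ a c, IntervalIntegrable g volume a c := fun a c => hg.intervalIntegrable a c
  have hn : ∀ a c, IntervalIntegrable (fun t => ‖g t‖) volume a c :=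
    fun a c => hg.norm.intervalIntegrable a c
  have e1 : (∫ t in (0 : ℝ)..P, g t) =
      (∫ t in (0 : ℝ)..x, g t) + (∫ t in x..y, g t) + ∫ t in y..P, g t := by
    rw [integral_add_adjacent_intervals (hi _ _) (hi _ _),
      integral_add_adjacent_intervals (hi _ _) (hi _ _)]
  have e2 : (∫ t in (0 : ℝ)..P, ‖g t‖) =
      (∫ t in (0 : ℝ)..x, ‖g t‖) + (∫ t in x..y, ‖g t‖) + ∫ t in y..P, ‖g t‖ := by
    rw [integral_add_adjacent_intervals (hn _ _) (hn _ _),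
      integral_add_adjacent_intervals (hn _ _) (hn _ _)]
  -- The integral over `[x, y]` is minus the integral over the complement, so the `L¹` norm bounds
  -- it twice over.
  have e3 : (∫ t in x..y, g t) = -((∫ t in (0 : ℝ)..x, g t) + ∫ t in y..P, g t) := by
    rw [h0] at e1
    linear_combination -e1
  have b1 := norm_integral_le_integral_norm (f := g) (μ := volume) hx
  have b2 := norm_integral_le_integral_norm (f := g) (μ := volume) hxy
  have b3 := norm_integral_le_integral_norm (f := g) (μ := volume) hy
  have b4 : ‖∫ t in x..y, g t‖ ≤ ‖∫ t in (0 : ℝ)..x, g t‖ + ‖∫ t in y..P, g t‖ := by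
    rw [e3, norm_neg]; exact norm_add_le _ _
  linarith

theorem periodic_primitive {g : ℝ → ℂ} (hg : Continuous g) {P : ℝ} (hp : Function.Periodic g P)
    (h0 : ∫ t in (0 : ℝ)..P, g t = 0) :
    Function.Periodic (fun x => ∫ t in (0 : ℝ)..x, g t) P := by
  intro x
  have e := hp.intervalIntegral_add_eq x 0
  rw [zero_add, h0] at e
  simp only
  rw [← integral_add_adjacent_intervals (hg.intervalIntegrable 0 x)
    (hg.intervalIntegrable x (x + P)), e, add_zero]

theorem norm_primitive_le_half {g : ℝ → ℂ} (hg : Continuous g) {P : ℝ} (hP : 0 < P)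
    (hp : Function.Periodic g P) (h0 : ∫ t in (0 : ℝ)..P, g t = 0) (x : ℝ) :
    ‖∫ t in (0 : ℝ)..x, g t‖ ≤ (∫ t in (0 : ℝ)..P, ‖g t‖) / 2 := by
  obtain ⟨y, hy, e⟩ := (periodic_primitive hg hp h0).exists_mem_Ico₀ hP x
  rw [e]
  exact norm_integral_le_half hg h0 le_rfl hy.1 hy.2.le

theorem integral_nat_mul_period {E : Type*} [NormedAddCommGroup E] [NormedSpace ℝ E]
    {g : ℝ → E} (hg : Continuous g) {P : ℝ} (hp : Function.Periodic g P) (n : ℕ) :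
    ∫ t in (0 : ℝ)..(n * P), g t = n • ∫ t in (0 : ℝ)..P, g t := by
  have := hp.intervalIntegral_add_zsmul_eq n 0 (hg.intervalIntegrable)
  simpa using this

/-- A continuous `P`-periodic function with mean `I` and controlled oscillation. -/
structure MeanBound (φ : ℝ → ℂ) (P : ℝ) (I : ℂ) (D E : ℝ) : Prop where
  cont : Continuous φ
  per : Function.Periodic φ P
  mean : ∫ t in (0 : ℝ)..P, φ t = P * I
  dev : ∀ x, ‖φ x - I‖ ≤ D
  prim : ∀ x, ‖∫ t in (0 : ℝ)..x, (φ t - I)‖ ≤ E * P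

theorem MeanBound.nat_mul {φ : ℝ → ℂ} {P : ℝ} {I : ℂ} {D E : ℝ} (hφ : MeanBound φ P I D E)
    (hP : 0 ≤ P) (hE : 0 ≤ E) {n : ℕ} (hn : 1 ≤ n) : MeanBound φ (n * P) I D E where
  cont := hφ.cont
  per := hφ.per.nat_mul n
  mean := by
    rw [integral_nat_mul_period hφ.cont hφ.per, hφ.mean]
    simp [mul_assoc]
  dev := hφ.dev
  prim x := by
    refine (hφ.prim x).trans ?_
    have : (1 : ℝ) ≤ n := by exact_mod_cast hn
    gcongr
    nlinarith

/-! ### Primitives of a step function times a periodic function. -/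

theorem measurable_zpow_floor (ω : ℂ) (h : ℝ) : Measurable fun t : ℝ => ω ^ ⌊t / h⌋ :=
  (measurable_of_countable fun n : ℤ => ω ^ n).comp
    (Int.measurable_floor.comp (measurable_id.div_const h))

theorem intervalIntegrable_zpow_floor_mul {φ : ℝ → ℂ} (hφ : Continuous φ) {ω : ℂ}
    (hω : ‖ω‖ = 1) (h a c : ℝ) :
    IntervalIntegrable (fun t => ω ^ ⌊t / h⌋ * φ t) volume a c := by
  have h1 := (hφ.intervalIntegrable (μ := volume) a c)
  rw [intervalIntegrable_iff] at h1 ⊢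
  exact h1.bdd_mul (c := 1) (measurable_zpow_floor ω h).aestronglyMeasurable
    (Filter.Eventually.of_forall fun x => by simp [hω])

/-- The primitive of `φ` multiplied by a step function of step size `h`. -/
noncomputable def stepPrimitive (ω : ℂ) (h : ℝ) (φ : ℝ → ℂ) (x : ℝ) : ℂ :=
  ∫ t in (0 : ℝ)..x, ω ^ ⌊t / h⌋ * φ t

theorem continuous_stepPrimitive {φ : ℝ → ℂ} (hφ : Continuous φ) {ω : ℂ} (hω : ‖ω‖ = 1) (h : ℝ) :
    Continuous (stepPrimitive ω h φ) :=
  continuous_primitive (intervalIntegrable_zpow_floor_mul hφ hω h) 0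

theorem stepPrimitive_of_mem {φ : ℝ → ℂ} {ω : ℂ} {h x : ℝ} (hx : 0 ≤ x) (hxh : x ≤ h) :
    stepPrimitive ω h φ x = ∫ t in (0 : ℝ)..x, φ t := by
  unfold stepPrimitive
  rw [integral_of_le hx, integral_of_le hx, ← integral_Ico_eq_integral_Ioc,
    ← integral_Ico_eq_integral_Ioc]
  refine setIntegral_congr_fun measurableSet_Ico fun t ht => ?_
  have hh : 0 < h := by linarith [ht.1, ht.2]
  have : ⌊t / h⌋ = 0 := by
    rw [Int.floor_eq_iff]
    refine ⟨by simpa using div_nonneg ht.1 hh.le, ?_⟩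
    rw [div_lt_iff₀ hh]; push_cast; linarith [ht.2]
  simp [this]

theorem stepPrimitive_add {φ : ℝ → ℂ} (hφ : Continuous φ) {ω : ℂ} (hω : ‖ω‖ = 1) {h : ℝ}
    (hh : 0 < h) (hp : Function.Periodic φ h) (x : ℝ) :
    stepPrimitive ω h φ (x + h) = (∫ t in (0 : ℝ)..h, φ t) + ω * stepPrimitive ω h φ x := by
  have hω0 : ω ≠ 0 := by rintro rfl; simp at hω
  have hi := intervalIntegrable_zpow_floor_mul hφ hω h
  rw [← stepPrimitive_of_mem (ω := ω) hh.le le_rfl]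
  unfold stepPrimitive
  rw [← integral_add_adjacent_intervals (hi 0 h) (hi h (x + h))]
  congr 1
  have := integral_comp_add_right (a := 0) (b := x) (fun t => ω ^ ⌊t / h⌋ * φ t) h
  rw [zero_add] at this
  rw [← this, ← intervalIntegral.integral_const_mul]
  refine integral_congr fun t _ => ?_
  rw [hp t, add_div, div_self hh.ne', Int.floor_add_one, zpow_add_one₀ hω0]
  ring

/-- A shift by `h` sends the value `F` to `h * I + ω * F`; centring at the fixed point `h * I / (1 -
ω)` makes this linear. That point is then the mean of the primitive. -/
theorem stepPrimitive_sub_add {φ : ℝ → ℂ} (hφ : Continuous φ) {ω : ℂ} (hω : ‖ω‖ = 1)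
    (hω1 : ω ≠ 1) {h : ℝ} (hh : 0 < h) (hp : Function.Periodic φ h) {I : ℂ}
    (hI : ∫ t in (0 : ℝ)..h, φ t = h * I) (x : ℝ) :
    stepPrimitive ω h φ (x + h) - h * I / (1 - ω) =
      ω * (stepPrimitive ω h φ x - h * I / (1 - ω)) := by
  rw [stepPrimitive_add hφ hω hh hp, hI]
  have : 1 - ω ≠ 0 := sub_ne_zero.2 hω1.symm
  field_simp
  ring

theorem periodic_of_add_eq_mul {g : ℝ → ℂ} {ω : ℂ} {h : ℝ} (hg : ∀ x, g (x + h) = ω * g x)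
    {b : ℕ} (hb : ω ^ b = 1) : Function.Periodic g (b * h) := by
  have key : ∀ (n : ℕ) x, g (x + n * h) = ω ^ n * g x := by
    intro n
    induction n with
    | zero => simp
    | succ n ih =>
      intro x
      rw [show x + ((n + 1 : ℕ) : ℝ) * h = (x + n * h) + h by push_cast; ring, hg, ih]
      ring
  intro x
  rw [key, hb, one_mul]

/-- Shifting by `h` preserves the integral over a full period but also multiplies it by `ω ≠ 1`. -/
theorem integral_eq_zero_of_add_eq_mul {g : ℝ → ℂ} {ω : ℂ} (hω1 : ω ≠ 1) {h : ℝ}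
    (hg : ∀ x, g (x + h) = ω * g x) {b : ℕ} (hb : ω ^ b = 1) :
    ∫ t in (0 : ℝ)..(b * h), g t = 0 := by
  have hp := periodic_of_add_eq_mul hg hb
  have e1 := hp.intervalIntegral_add_eq h 0
  have e2 := integral_comp_add_right (a := 0) (b := b * h) g h
  simp only [hg, intervalIntegral.integral_const_mul, zero_add] at e1 e2
  rw [add_comm (b * h : ℝ) h, e1] at e2
  have : (ω - 1) * ∫ t in (0 : ℝ)..(b * h), g t = 0 := by linear_combination e2
  exact (mul_eq_zero.1 this).resolve_left (sub_ne_zero.2 hω1)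

theorem norm_integral_sub_mean_le {φ : ℝ → ℂ} {h : ℝ} {I : ℂ} {D E : ℝ}
    (hφ : MeanBound φ h I D E) {y : ℝ} (hy : 0 ≤ y) (hyh : y ≤ h) :
    ‖∫ t in (0 : ℝ)..y, (φ t - I)‖ ≤ D * y ∧ ‖∫ t in (0 : ℝ)..y, (φ t - I)‖ ≤ D * (h - y) := by
  have hc : Continuous fun t => φ t - I := hφ.cont.sub continuous_const
  constructor
  · have := norm_integral_le_of_norm_le_const (a := 0) (b := y) (f := fun t => φ t - I)
      fun x _ => hφ.dev x
    simpa [abs_of_nonneg hy] using this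
  · have e := integral_add_adjacent_intervals (hc.intervalIntegrable (μ := volume) 0 y)
      (hc.intervalIntegrable y h)
    have e0 : ∫ t in (0 : ℝ)..h, (φ t - I) = 0 := by
      rw [intervalIntegral.integral_sub (hφ.cont.intervalIntegrable _ _) (by simp), hφ.mean]
      simp
    rw [e0] at e
    have := norm_integral_le_of_norm_le_const (a := y) (b := h) (f := fun t => φ t - I)
      fun x _ => hφ.dev x
    rw [abs_of_nonneg (by linarith)] at this
    rwa [eq_neg_of_add_eq_zero_left e, norm_neg]

theorem norm_one_sub_mul_add_le {ω : ℂ} (hω : ‖ω‖ = 1) {t : ℝ} (h0 : 0 ≤ t) (h1 : t ≤ 1) :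
    ‖1 - (t : ℂ) * (1 - ω)‖ ≤ 1 := by
  have e : (1 : ℂ) - t * (1 - ω) = ((1 - t : ℝ) : ℂ) + (t : ℂ) * ω := by push_cast; ring
  rw [e]
  refine (norm_add_le _ _).trans ?_
  rw [norm_mul, hω, Complex.norm_real, Complex.norm_real, Real.norm_of_nonneg h0,
    Real.norm_of_nonneg (by linarith)]
  linarith

theorem norm_integral_sub_stepMean_le {φ : ℝ → ℂ} {ω : ℂ} (hω : ‖ω‖ = 1)
    (hω1 : ω ≠ 1) {h : ℝ} (hh : 0 < h) {I : ℂ} (hc : Continuous φ) {y : ℝ}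
    (hy : 0 ≤ y) (hyh : y ≤ h) :
    ‖(∫ t in (0 : ℝ)..y, φ t) - h * I / (1 - ω)‖ ≤
      ‖h * I / (1 - ω)‖ + ‖∫ t in (0 : ℝ)..y, (φ t - I)‖ := by
  have h1 : 1 - ω ≠ 0 := sub_ne_zero.2 hω1.symm
  have hh' : (h : ℂ) ≠ 0 := by exact_mod_cast hh.ne'
  -- Split `φ = I + (φ - I)`. With `J` the new mean, the constant part gives `y * I - J = -J * (1 -
  -- (y / h) * (1 - ω))`, whose last factor is a convex combination of `1` and `ω`.
  have e : (∫ t in (0 : ℝ)..y, φ t) - h * I / (1 - ω) =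
      -(h * I / (1 - ω)) * (1 - ((y / h : ℝ) : ℂ) * (1 - ω)) +
        ∫ t in (0 : ℝ)..y, (φ t - I) := by
    rw [intervalIntegral.integral_sub (hc.intervalIntegrable _ _) (by simp)]
    simp only [intervalIntegral.integral_const, sub_zero, Complex.real_smul]
    push_cast
    field_simp
    ring
  rw [e]
  refine (norm_add_le _ _).trans ?_
  gcongr
  rw [norm_mul, norm_neg]
  have := norm_one_sub_mul_add_le hω (t := y / h) (by positivity) ((div_le_one hh).2 hyh)
  nlinarith [norm_nonneg (h * I / (1 - ω))]

/-- The two bounds feed each other: the new deviation is controlled by the old primitive, and the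
new primitive by half the `L¹` norm of the new deviation, hence by the old deviation. -/
theorem MeanBound.step {φ : ℝ → ℂ} {h : ℝ} {I : ℂ} {D E : ℝ} (hφ : MeanBound φ h I D E)
    (hh : 0 < h) {b : ℕ} (hb : 0 < b) {ω : ℂ} (hω : ‖ω‖ = 1) (hω1 : ω ≠ 1) (hωb : ω ^ b = 1) :
    MeanBound (stepPrimitive ω h φ) (b * h) (h * I / (1 - ω))
      (‖h * I / (1 - ω)‖ + E * h) ((‖h * I / (1 - ω)‖ + D * h / 4) / 2) := by
  set J := h * I / (1 - ω) with hJ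
  have hcF := continuous_stepPrimitive hφ.cont hω h
  have hs : ∀ x, (fun x => stepPrimitive ω h φ x - J) (x + h) =
      ω * (fun x => stepPrimitive ω h φ x - J) x :=
    stepPrimitive_sub_add hφ.cont hω hω1 hh hφ.per hφ.mean
  have hc : Continuous fun x => stepPrimitive ω h φ x - J := hcF.sub continuous_const
  have hper := periodic_of_add_eq_mul (g := fun x => stepPrimitive ω h φ x - J) hs hωb
  have hint := integral_eq_zero_of_add_eq_mul (g := fun x => stepPrimitive ω h φ x - J) hω1 hs hωb
  have hnper : Function.Periodic (fun x => ‖stepPrimitive ω h φ x - J‖) h := fun x => by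
    have := hs x
    simp only at this ⊢
    rw [this, norm_mul, hω, one_mul]
  have hbd : ∀ y, 0 ≤ y → y ≤ h → ‖stepPrimitive ω h φ y - J‖ ≤
      ‖J‖ + ‖∫ t in (0 : ℝ)..y, (φ t - I)‖ := fun y h0 h1 => by
    rw [stepPrimitive_of_mem h0 h1]
    exact norm_integral_sub_stepMean_le hω hω1 hh hφ.cont h0 h1
  refine ⟨hcF, fun x => ?_, ?_, fun x => ?_, fun x => ?_⟩
  · simpa using hper x
  · rw [intervalIntegral.integral_sub (hcF.intervalIntegrable _ _) (by simp), sub_eq_zero] at hint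
    rw [hint]
    simp
  · obtain ⟨y, hy, e⟩ := hnper.exists_mem_Ico₀ hh x
    rw [e]
    exact (hbd y hy.1 hy.2.le).trans (by gcongr; exact hφ.prim y)
  · refine (norm_primitive_le_half hc (by positivity) hper hint x).trans ?_
    rw [integral_nat_mul_period hc.norm hnper]
    have hi : ∀ a c, IntervalIntegrable (fun x => ‖stepPrimitive ω h φ x - J‖) volume a c :=
      fun a c => hc.norm.intervalIntegrable a c
    -- On one cell the primitive of `φ - I` lies below the tent `min (D * t) (D * (h - t))`, whose
    -- integral is `D * h ^ 2 / 4`.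
    have k1 : ∫ t in (0 : ℝ)..(h / 2), ‖stepPrimitive ω h φ t - J‖ ≤
        ∫ t in (0 : ℝ)..(h / 2), (‖J‖ + D * t) :=
      integral_mono_on (by positivity) (hi _ _) (Continuous.intervalIntegrable (by fun_prop) _ _)
        fun t ht => (hbd t ht.1 (by linarith [ht.2])).trans (by
          gcongr; exact (norm_integral_sub_mean_le hφ ht.1 (by linarith [ht.2])).1)
    have k2 : ∫ t in (h / 2)..h, ‖stepPrimitive ω h φ t - J‖ ≤
        ∫ t in (h / 2)..h, (‖J‖ + D * (h - t)) :=
      integral_mono_on (by linarith) (hi _ _) (Continuous.intervalIntegrable (by fun_prop) _ _)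
        fun t ht => (hbd t (by linarith [ht.1]) ht.2).trans (by
          gcongr; exact (norm_integral_sub_mean_le hφ (by linarith [ht.1]) ht.2).2)
    have k3 : ∫ t in (0 : ℝ)..(h / 2), (‖J‖ + D * t) = ‖J‖ * (h / 2) + D * h ^ 2 / 8 := by
      rw [intervalIntegral.integral_add (by simp) (Continuous.intervalIntegrable (by fun_prop) _ _),
        intervalIntegral.integral_const_mul]
      simp
      ring
    have k4 : ∫ t in (h / 2)..h, (‖J‖ + D * (h - t)) = ‖J‖ * (h / 2) + D * h ^ 2 / 8 := by
      rw [intervalIntegral.integral_add (by simp) (Continuous.intervalIntegrable (by fun_prop) _ _),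
        intervalIntegral.integral_const_mul, intervalIntegral.integral_sub (by simp) (by simp)]
      simp
      ring
    rw [k3] at k1
    rw [k4] at k2
    rw [← integral_add_adjacent_intervals (hi 0 (h / 2)) (hi (h / 2) h), nsmul_eq_mul]
    have : (0 : ℝ) ≤ b := by positivity
    nlinarith

/-! ### Estimates for the constants `m_b` and `M_b`. -/

theorem mConst_le_norm_one_sub {b : ℕ} (hb : 2 ≤ b) {ω : ℂ} (hωb : ω ^ b = 1) (hω1 : ω ≠ 1) :
    mConst b ≤ ‖1 - ω‖ := by
  have hb0 : b ≠ 0 := by omega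
  have : NeZero b := ⟨hb0⟩
  have hbR : (0 : ℝ) < b := by positivity
  have hu : IsUnit ω := IsUnit.of_pow_eq_one hωb hb0
  obtain ⟨i, hi, e⟩ := (Complex.mem_rootsOfUnity b hu.unit).1 (by
    rw [mem_rootsOfUnity]; ext; simpa using hωb)
  have hi0 : i ≠ 0 := by rintro rfl; apply hω1; simpa using e.symm
  have e2 : ω = Complex.exp (Complex.I * ((2 * (Real.pi * i / b) : ℝ) : ℂ)) := by
    have : (hu.unit : ℂ) = ω := rfl
    rw [← this, ← e]; congr 1; push_cast; ring
  rw [norm_sub_rev, e2, Complex.norm_exp_I_mul_ofReal_sub_one]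
  have h1 : (1 : ℝ) ≤ i := by exact_mod_cast Nat.one_le_iff_ne_zero.2 hi0
  have h2 : (i : ℝ) + 1 ≤ b := by exact_mod_cast hi
  have hpi := Real.pi_pos
  rw [mul_div_cancel_left₀ _ two_ne_zero]
  refine le_trans ?_ (le_abs_self _)
  unfold mConst
  refine mul_le_mul_of_nonneg_left ?_ two_pos.le
  have a1 : Real.pi / b ≤ Real.pi * i / b := by gcongr; nlinarith
  have a2 : Real.pi * i / b ≤ Real.pi - Real.pi / b := by
    rw [← sub_nonneg]
    have : Real.pi - Real.pi / b - Real.pi * i / b = Real.pi * (b - (i + 1)) / b := by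
      field_simp; ring
    rw [this]; exact div_nonneg (mul_nonneg hpi.le (by linarith)) hbR.le
  have a3 : Real.pi / b ≤ Real.pi / 2 := by gcongr; exact_mod_cast hb
  rcases le_total (Real.pi * i / b) (Real.pi / 2) with h | h
  · exact Real.sin_le_sin_of_le_of_le_pi_div_two (by linarith [div_pos hpi hbR]) h a1
  · rw [← Real.sin_pi_sub (Real.pi * i / b)]
    exact Real.sin_le_sin_of_le_of_le_pi_div_two (by linarith [div_pos hpi hbR]) (by linarith)
      (by linarith)

theorem mConst_two : mConst 2 = 2 := by simp [mConst]

theorem four_div_le_mConst {b : ℕ} (hb : 2 ≤ b) : 4 / b ≤ mConst b := by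
  have hbR : (2 : ℝ) ≤ b := by exact_mod_cast hb
  have hpi := Real.pi_pos
  have := Real.mul_le_sin (x := Real.pi / b) (by positivity) (by gcongr)
  unfold mConst
  have e : 2 / Real.pi * (Real.pi / b) = 2 / b := by field_simp
  rw [e] at this
  calc (4 : ℝ) / b = 2 * (2 / b) := by ring
    _ ≤ _ := by gcongr

theorem mConst_pos {b : ℕ} (hb : 2 ≤ b) : 0 < mConst b :=
  lt_of_lt_of_le (div_pos four_pos (Nat.cast_pos.2 (by omega))) (four_div_le_mConst hb)

theorem mConst_le_two (b : ℕ) : mConst b ≤ 2 := by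
  unfold mConst; linarith [Real.sin_le_one (Real.pi / b)]

theorem sin_pi_div_antitone {c b : ℕ} (hc : 2 ≤ c) (hcb : c ≤ b) :
    Real.sin (Real.pi / b) ≤ Real.sin (Real.pi / c) := by
  have hpi := Real.pi_pos
  have hc' : (2 : ℝ) ≤ c := by exact_mod_cast hc
  have hb' : (c : ℝ) ≤ b := by exact_mod_cast hcb
  have h0 : 0 < Real.pi / b := div_pos hpi (by linarith)
  refine Real.sin_le_sin_of_le_of_le_pi_div_two (by linarith) ?_ ?_ <;> gcongr

theorem mConst_sq_le_three {b : ℕ} (hb : 3 ≤ b) : mConst b ^ 2 ≤ 3 := by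
  have h1 := sin_pi_div_antitone (by norm_num) hb
  have h2 := mConst_pos (b := b) (by omega)
  push_cast at h1
  rw [Real.sin_pi_div_three] at h1
  have h3 : mConst b ≤ √3 := by unfold mConst; linarith
  nlinarith [Real.sq_sqrt (show (0 : ℝ) ≤ 3 by norm_num), Real.sqrt_nonneg 3]

theorem mConst_sq_le_two {b : ℕ} (hb : 4 ≤ b) : mConst b ^ 2 ≤ 2 := by
  have h1 := sin_pi_div_antitone (by norm_num) hb
  have h2 := mConst_pos (b := b) (by omega)
  push_cast at h1
  rw [Real.sin_pi_div_four] at h1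
  have h3 : mConst b ≤ √2 := by unfold mConst; linarith
  nlinarith [Real.sq_sqrt (show (0 : ℝ) ≤ 2 by norm_num), Real.sqrt_nonneg 2]

theorem MConst_le_two (b : ℕ) : MConst b ≤ 2 := by
  unfold MConst
  split_ifs
  · exact le_rfl
  · linarith [Real.sin_le_one ((b + 1) * Real.pi / (2 * b))]

/-- For odd `b`, `M_b = 2 cos (π / (2b))`; then `2 - 2 cos t ≤ t ^ 2` and `π ^ 2 ≤ 10`. -/
theorem two_sub_MConst_le {b : ℕ} (hb : 2 ≤ b) : 2 - MConst b ≤ 5 / 2 / b ^ 2 := by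
  have hbR : (0 : ℝ) < b := by positivity
  unfold MConst
  split_ifs
  · simp; positivity
  · have e : ((b : ℝ) + 1) * Real.pi / (2 * b) = Real.pi / (2 * b) + Real.pi / 2 := by
      field_simp
      ring
    rw [e, Real.sin_add_pi_div_two]
    have h1 := Real.one_sub_sq_div_two_le_cos (x := Real.pi / (2 * b))
    have h2 : Real.pi ^ 2 ≤ 10 := by nlinarith [Real.pi_lt_d2, Real.pi_pos]
    have h3 : (Real.pi / (2 * b)) ^ 2 ≤ 5 / 2 / (b : ℝ) ^ 2 := by
      rw [div_pow, mul_pow, div_le_div_iff₀ (by positivity) (by positivity)]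
      nlinarith [sq_nonneg (b : ℝ)]
    linarith

theorem one_le_MConst {b : ℕ} (hb : 2 ≤ b) : 1 ≤ MConst b := by
  have h := two_sub_MConst_le hb
  have hbR : (2 : ℝ) ≤ b := by exact_mod_cast hb
  have : 5 / 2 / (b : ℝ) ^ 2 ≤ 1 := by
    rw [div_le_one (by positivity)]; nlinarith
  linarith

/-- A bound for the relative deviation from the mean that is stable under `MeanBound.step`. -/
noncomputable def devConst (b : ℕ) : ℝ := (1 + mConst b / 2) / (1 - mConst b ^ 2 / 8)

theorem one_add_devConst_le {b : ℕ} (hb : 3 ≤ b) :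
    1 + devConst b ≤ MConst b + b * mConst b / (b - MConst b) := by
  have hbR : (3 : ℝ) ≤ b := by exact_mod_cast hb
  have hm := mConst_pos (b := b) (by omega)
  have hM2 := MConst_le_two b
  have hM1 := one_le_MConst (b := b) (by omega)
  have h3 := mConst_sq_le_three hb
  have h4 := four_div_le_mConst (b := b) (by omega)
  have h5 := two_sub_MConst_le (b := b) (by omega)
  have e1 : devConst b = 1 + mConst b * ((4 + mConst b) / (8 - mConst b ^ 2)) := by
    unfold devConst
    have : 1 - mConst b ^ 2 / 8 ≠ 0 := by linarith
    have : 8 - mConst b ^ 2 ≠ 0 := by linarith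
    field_simp
    ring
  have hm4 : 4 ≤ b → mConst b ^ 2 ≤ 2 := mConst_sq_le_two
  rw [e1]
  generalize mConst b = m at *
  generalize MConst b = M at *
  have hbM : 0 < (b : ℝ) - M := by linarith
  have hd : 0 < 8 - m ^ 2 := by linarith
  have hm2 : m ≤ 1.7321 := by nlinarith
  -- A factor `m` is extracted using `4 / b ≤ m`, with `0.625 = (5 / 2) / 4`; the claim can then be
  -- divided by `m`.
  have e2 : 2 - M ≤ m * (0.625 / b) := by
    calc 2 - M ≤ 5 / 2 / b ^ 2 := h5
      _ = 4 / b * (0.625 / b) := by field_simp; norm_num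
      _ ≤ _ := by gcongr
  have e3 : 0.625 / b + (4 + m) / (8 - m ^ 2) ≤ b / (b - M) := by
    -- `b = 3` is separate: there `m = √3`, and `(4 + m) / (8 - m ^ 2)` exceeds `1`.
    rcases eq_or_lt_of_le hb with rfl | hb4
    · push_cast
      have a1 : (4 + m) / (8 - m ^ 2) ≤ 1.2 := by
        rw [div_le_iff₀ hd]; linarith
      have a2 : (1.5 : ℝ) ≤ 3 / (3 - M) := by
        rw [le_div_iff₀ (by push_cast at hbM; exact hbM)]; linarith
      norm_num at a1 a2 ⊢
      linarith
    · have h2 : m ^ 2 ≤ 2 := hm4 hb4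
      have a1 : (4 + m) / (8 - m ^ 2) ≤ 1 := by
        rw [div_le_one hd]; nlinarith
      have a2 : 1 + 0.625 / b ≤ b / (b - M) := by
        rw [le_div_iff₀ hbM, add_mul, div_mul_eq_mul_div]
        have : 0.625 * (b - M) / b ≤ 1 := by
          rw [div_le_one (by linarith)]; nlinarith
        linarith
      linarith
  have e4 : b * m / (b - M) = m * (b / (b - M)) := by ring
  rw [e4]
  nlinarith

/-! ### Families stable under taking step primitives. -/

/-- A class `S` of periodic functions, `S φ P B` meaning that `φ` has period `P` and size `B`, which
is closed under the operations by which iterated primitives of Walsh functions are formed. -/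
structure StepFamily (b : ℕ) (T₁ T₂ : ℝ) (S : (ℝ → ℂ) → ℝ → ℝ → Prop) : Prop where
  le : T₁ ≤ T₂
  one_le : 1 ≤ T₁
  cont : ∀ {φ P B}, S φ P B → Continuous φ
  per : ∀ {φ P B}, S φ P B → Function.Periodic φ P
  one : ∀ {P}, 0 < P → S (fun _ => 1) P 1
  nat_mul : ∀ {φ P B} {n : ℕ}, 0 < P → 0 ≤ B → 1 ≤ n → S φ P B → S φ (n * P) B
  step : ∀ {φ h B ω}, 0 < h → 0 ≤ B → ‖ω‖ = 1 → ω ≠ 1 → ω ^ b = 1 → S φ h B →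
    S (stepPrimitive ω h φ) (b * h) (h * B / mConst b)
  mean_le : ∀ {φ B}, 0 ≤ B → S φ 1 B → ‖∫ t in (0 : ℝ)..1, φ t‖ ≤ T₁ * B
  dev_le : ∀ {φ B}, 0 ≤ B → S φ 1 B → ∀ x, ‖φ x - ∫ t in (0 : ℝ)..1, φ t‖ ≤ T₁ * B
  norm_le : ∀ {φ P B}, 0 ≤ B → S φ P B → ∀ x, ‖φ x‖ ≤ T₂ * B

/-- Functions with relative deviation `devConst b` from the mean. -/
def NonDyadicState (b : ℕ) (φ : ℝ → ℂ) (P B : ℝ) : Prop :=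
  ∃ I, ‖I‖ ≤ B ∧
    MeanBound φ P I (devConst b * B) ((1 + mConst b * devConst b / 4) / 2 * B)

theorem MeanBound.mono {φ : ℝ → ℂ} {P : ℝ} {I : ℂ} {D E D' E' : ℝ} (h : MeanBound φ P I D E)
    (hP : 0 ≤ P) (hD : D ≤ D') (hE : E ≤ E') : MeanBound φ P I D' E' :=
  ⟨h.cont, h.per, h.mean, fun x => (h.dev x).trans hD, fun x => (h.prim x).trans (by gcongr)⟩

theorem stepFamily_nonDyadic {b : ℕ} (hb : 3 ≤ b) :
    StepFamily b (1 + b * mConst b / (b - MConst b)) (MConst b + b * mConst b / (b - MConst b))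
      (NonDyadicState b) := by
  have hm := mConst_pos (b := b) (by omega)
  have h3 := mConst_sq_le_three hb
  have hT := one_add_devConst_le hb
  have hM2 := MConst_le_two b
  have hM1 := one_le_MConst (b := b) (by omega)
  have hbR : (3 : ℝ) ≤ b := by exact_mod_cast hb
  have hd0 : 0 ≤ devConst b := div_nonneg (by positivity) (by linarith)
  -- Relative to the size, one step sends the bounds `(D, E)` to `(1 + m * E, (1 + m * D / 4) / 2)`;
  -- `devConst b` is the `D` of the fixed point.
  have hd : 1 + mConst b * ((1 + mConst b * devConst b / 4) / 2) = devConst b := by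
    unfold devConst
    have : 1 - mConst b ^ 2 / 8 ≠ 0 := by linarith
    have : 8 - mConst b ^ 2 ≠ 0 := by linarith
    field_simp
    ring
  have hpos : 0 ≤ b * mConst b / (b - MConst b) := div_nonneg (by positivity) (by linarith)
  refine ⟨by linarith, by linarith, fun ⟨I, _, h⟩ => h.cont, fun ⟨I, _, h⟩ => h.per, fun hP => ?_,
    fun hP hB hn ⟨I, hI, h⟩ => ⟨I, hI, h.nat_mul hP.le (by positivity) hn⟩, ?_, ?_, ?_, ?_⟩
  · have : 0 ≤ (1 + mConst b * devConst b / 4) / 2 := by positivity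
    refine ⟨1, by simp, continuous_const, fun _ => rfl, by simp, fun x => by simpa using hd0,
      fun x => ?_⟩
    simpa using mul_nonneg this hP.le
  · rintro φ h B ω hh hB hω hω1 hωb ⟨I, hI, hφ⟩
    have hle := mConst_le_norm_one_sub (by omega) hωb hω1
    have hJ : ‖h * I / (1 - ω)‖ ≤ h * B / mConst b := by
      rw [norm_div, norm_mul, Complex.norm_real, Real.norm_of_nonneg hh.le]
      gcongr
    refine ⟨_, hJ, (hφ.step hh (by omega) hω hω1 hωb).mono (by positivity) ?_ ?_⟩
    · have e : h * B / mConst b + (1 + mConst b * devConst b / 4) / 2 * B * h =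
          (1 + mConst b * ((1 + mConst b * devConst b / 4) / 2)) * (h * B / mConst b) := by
        field_simp
      rw [hd] at e
      rw [← e]
      gcongr
    · have : (h * B / mConst b + devConst b * B * h / 4) / 2 =
        (1 + mConst b * devConst b / 4) / 2 * (h * B / mConst b) := by field_simp
      rw [← this]
      gcongr
  · rintro φ B hB ⟨I, hI, hφ⟩
    rw [hφ.mean]
    simp only [Complex.ofReal_one, one_mul]
    nlinarith
  · rintro φ B hB ⟨I, hI, hφ⟩ x
    rw [hφ.mean]
    simp only [Complex.ofReal_one, one_mul]
    refine (hφ.dev x).trans ?_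
    gcongr
    linarith
  · rintro φ P B hB ⟨I, hI, hφ⟩ x
    have h1 := hφ.dev x
    have h2 : ‖φ x‖ ≤ ‖φ x - I‖ + ‖I‖ := by simpa using norm_add_le (φ x - I) I
    nlinarith

/-- Nonnegative functions bounded by twice their mean. -/
structure DyadicState (φ : ℝ → ℂ) (P B : ℝ) : Prop where
  cont : Continuous φ
  per : Function.Periodic φ P
  mean : ∃ I : ℝ, I ≤ B ∧ ∫ t in (0 : ℝ)..P, φ t = P * I ∧
    ∀ x, ∃ r : ℝ, 0 ≤ r ∧ r ≤ 2 * I ∧ φ x = r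

/-- Here `ω = -1`: the primitive of `φ ≥ 0` increases from `0` to `h * I` on `[0, h]` and returns
symmetrically on `[h, 2h]`. It thus has mean `h * I / 2` and is at most twice that. -/
theorem stepFamily_dyadic : StepFamily 2 1 2 DyadicState := by
  refine ⟨by norm_num, le_rfl, fun h => h.cont, fun h => h.per, fun hP => ?_, ?_, ?_, ?_, ?_, ?_⟩
  · exact ⟨continuous_const, fun _ => rfl, 1, le_rfl, by simp,
      fun x => ⟨1, zero_le_one, by norm_num, by simp⟩⟩
  · rintro φ P B n hP hB hn ⟨hc, hp, I, hI, hm, hr⟩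
    refine ⟨hc, hp.nat_mul n, I, hI, ?_, hr⟩
    rw [integral_nat_mul_period hc hp, hm]
    simp [mul_assoc]
  · rintro φ h B ω hh hB hω hω1 hωb ⟨hc, hp, I, hI, hm, hr⟩
    have hω2 : ω = -1 := (sq_eq_one_iff.1 hωb).resolve_left hω1
    have hs : ∀ x, stepPrimitive ω h φ (x + h) - h * I / (1 - ω) =
        ω * (stepPrimitive ω h φ x - h * I / (1 - ω)) :=
      stepPrimitive_sub_add hc hω hω1 hh hp hm
    have hadd := stepPrimitive_add hc hω hh hp
    have hcF := continuous_stepPrimitive hc hω h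
    have hper := periodic_of_add_eq_mul (g := fun x => stepPrimitive ω h φ x - h * I / (1 - ω))
      hs hωb
    have hper' : Function.Periodic (stepPrimitive ω h φ) ((2 : ℕ) * h) :=
      fun x => by simpa using hper x
    have hint := integral_eq_zero_of_add_eq_mul
      (g := fun x => stepPrimitive ω h φ x - h * I / (1 - ω)) hω1 hs hωb
    rw [intervalIntegral.integral_sub (hcF.intervalIntegrable _ _) (by simp), sub_eq_zero] at hint
    refine ⟨hcF, hper', h * I / 2, ?_, ?_, ?_⟩
    · rw [mConst_two]; gcongr
    · rw [hint, hω2]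
      simp
      ring
    have hre : ∀ x, φ x = (((φ x).re : ℝ) : ℂ) ∧ 0 ≤ (φ x).re := fun x => by
      obtain ⟨r, h0, -, e⟩ := hr x
      simp [e, h0]
    have hci : ∀ a c, IntervalIntegrable (fun x => (φ x).re) volume a c :=
      fun a c => (Complex.continuous_re.comp hc).intervalIntegrable a c
    have hof : ∀ y, ∫ t in (0 : ℝ)..y, φ t = ((∫ t in (0 : ℝ)..y, (φ t).re : ℝ) : ℂ) := fun y => by
      rw [← intervalIntegral.integral_ofReal]
      exact integral_congr fun t _ => (hre t).1
    have hI2 : ∫ t in (0 : ℝ)..h, (φ t).re = h * I := by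
      have := hof h
      rw [hm] at this
      exact_mod_cast this.symm
    have key : ∀ x, 0 ≤ x → x ≤ h →
        ∃ r : ℝ, 0 ≤ r ∧ r ≤ 2 * (h * I / 2) ∧ stepPrimitive ω h φ x = r := fun x hx hxh => by
      refine ⟨∫ t in (0 : ℝ)..x, (φ t).re, integral_nonneg hx fun t _ => (hre t).2, ?_, ?_⟩
      · have e := integral_add_adjacent_intervals (hci 0 x) (hci x h)
        have : 0 ≤ ∫ t in x..h, (φ t).re := integral_nonneg hxh fun t _ => (hre t).2
        linarith
      · rw [stepPrimitive_of_mem hx hxh, hof]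
    intro x
    obtain ⟨y, hy, e⟩ := hper'.exists_mem_Ico₀ (by positivity) x
    rw [e]
    rcases le_total y h with hyh | hyh
    · exact key y hy.1 hyh
    · have h2 := hy.2
      push_cast at h2
      obtain ⟨r, r0, r1, er⟩ := key (y - h) (by linarith) (by linarith)
      have := hadd (y - h)
      rw [sub_add_cancel, er, hm, hω2] at this
      refine ⟨h * I - r, by linarith, by linarith, ?_⟩
      rw [hω2, this]
      push_cast
      ring
  · rintro φ B hB ⟨hc, hp, I, hI, hm, hr⟩
    obtain ⟨r, h0, h1, -⟩ := hr 0
    rw [hm, Complex.ofReal_one, one_mul, Complex.norm_real, Real.norm_of_nonneg (by linarith)]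
    linarith
  · rintro φ B hB ⟨hc, hp, I, hI, hm, hr⟩ x
    obtain ⟨r, h0, h1, e⟩ := hr x
    rw [hm, e, Complex.ofReal_one, one_mul, ← Complex.ofReal_sub, Complex.norm_real,
      Real.norm_eq_abs, abs_le]
    constructor <;> linarith
  · rintro φ P B hB ⟨hc, hp, I, hI, hm, hr⟩ x
    obtain ⟨r, h0, h1, e⟩ := hr x
    rw [e, Complex.norm_real, Real.norm_of_nonneg h0]
    linarith

/-! ### Integration by parts for absolutely continuous functions. -/

theorem integral_mul_eq_neg_integral_deriv_mul_real {g w : ℝ → ℝ}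
    (hg : AbsolutelyContinuousOnInterval g 0 1) (hw : IntervalIntegrable w volume 0 1)
    (h1 : ∫ t in (0 : ℝ)..1, w t = 0) :
    ∫ x in (0 : ℝ)..1, g x * w x =
      -∫ x in (0 : ℝ)..1, derivWithin g (Set.Icc 0 1) x * ∫ t in (0 : ℝ)..x, w t := by
  have hW := hw.absolutelyContinuousOnInterval_intervalIntegral (c := 0) (by simp)
  have key := hg.integral_mul_deriv_eq_deriv_mul hW
  rw [h1] at key
  simp only [integral_same, mul_zero, sub_zero, zero_sub] at key
  -- As `w` is merely integrable, its primitive has derivative `w` only almost everywhere.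
  have e1 : ∫ x in (0 : ℝ)..1, g x * w x =
      ∫ x in (0 : ℝ)..1, g x * deriv (fun x => ∫ t in (0 : ℝ)..x, w t) x := by
    refine integral_congr_ae ?_
    filter_upwards [hw.ae_hasDerivAt_integral] with x hx hx'
    rw [(hx (Set.uIoc_subset_uIcc hx') 0 (by simp)).deriv]
  have e2 : ∫ x in (0 : ℝ)..1, derivWithin g (Set.Icc 0 1) x * ∫ t in (0 : ℝ)..x, w t =
      ∫ x in (0 : ℝ)..1, deriv g x * ∫ t in (0 : ℝ)..x, w t := by
    refine integral_congr_ae ?_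
    have hne : ∀ᵐ x : ℝ, x ≠ 1 := by simp [ae_iff, measure_singleton]
    filter_upwards [hne] with x hx hx'
    rw [Set.uIoc_of_le zero_le_one] at hx'
    rw [derivWithin_of_mem_nhds (Icc_mem_nhds hx'.1 (lt_of_le_of_ne hx'.2 hx))]
  rw [e1, key, e2]

theorem intervalIntegrable_ofReal {g : ℝ → ℝ} {a c : ℝ} (hg : IntervalIntegrable g volume a c) :
    IntervalIntegrable (fun x => (g x : ℂ)) volume a c :=
  ⟨hg.1.ofReal, hg.2.ofReal⟩

theorem re_intervalIntegral {f : ℝ → ℂ} {a c : ℝ} (hf : IntervalIntegrable f volume a c) :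
    (∫ t in a..c, f t).re = ∫ t in a..c, (f t).re :=
  (Complex.reCLM.intervalIntegral_comp_comm hf).symm

theorem im_intervalIntegral {f : ℝ → ℂ} {a c : ℝ} (hf : IntervalIntegrable f volume a c) :
    (∫ t in a..c, f t).im = ∫ t in a..c, (f t).im :=
  (Complex.imCLM.intervalIntegral_comp_comm hf).symm

theorem intervalIntegrable_derivWithin {g : ℝ → ℝ} (hg : AbsolutelyContinuousOnInterval g 0 1) :
    IntervalIntegrable (derivWithin g (Set.Icc 0 1)) volume 0 1 := by
  refine hg.intervalIntegrable_deriv.congr_ae ?_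
  rw [Filter.EventuallyEq, ae_restrict_iff' measurableSet_uIoc]
  have hne : ∀ᵐ x : ℝ, x ≠ 1 := by simp [ae_iff, measure_singleton]
  filter_upwards [hne] with x hx hx'
  rw [Set.uIoc_of_le zero_le_one] at hx'
  rw [derivWithin_of_mem_nhds (Icc_mem_nhds hx'.1 (lt_of_le_of_ne hx'.2 hx))]

theorem integral_mul_eq_neg_integral_derivWithin_mul {g : ℝ → ℝ} {w : ℝ → ℂ}
    (hg : AbsolutelyContinuousOnInterval g 0 1) (hw : ∀ a c, IntervalIntegrable w volume a c)
    (h1 : ∫ t in (0 : ℝ)..1, w t = 0) :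
    ∫ x in (0 : ℝ)..1, (g x : ℂ) * w x =
      -∫ x in (0 : ℝ)..1, ((derivWithin g (Set.Icc 0 1) x : ℝ) : ℂ) * ∫ t in (0 : ℝ)..x, w t := by
  have hW : Continuous fun x => ∫ t in (0 : ℝ)..x, w t := continuous_primitive hw 0
  have i1 : IntervalIntegrable (fun x => (g x : ℂ) * w x) volume 0 1 :=
    (hw 0 1).continuousOn_mul (Complex.continuous_ofReal.comp_continuousOn hg.continuousOn)
  have i2 : IntervalIntegrable (fun x => ((derivWithin g (Set.Icc 0 1) x : ℝ) : ℂ) *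
      ∫ t in (0 : ℝ)..x, w t) volume 0 1 :=
    (intervalIntegrable_ofReal (intervalIntegrable_derivWithin hg)).mul_continuousOn hW.continuousOn
  have hre : IntervalIntegrable (fun t => (w t).re) volume 0 1 :=
    ⟨(hw 0 1).1.re, (hw 0 1).2.re⟩
  have him : IntervalIntegrable (fun t => (w t).im) volume 0 1 :=
    ⟨(hw 0 1).1.im, (hw 0 1).2.im⟩
  apply Complex.ext
  · rw [Complex.neg_re, re_intervalIntegral i1, re_intervalIntegral i2]
    simp only [Complex.re_ofReal_mul, re_intervalIntegral (hw _ _)]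
    refine integral_mul_eq_neg_integral_deriv_mul_real hg hre ?_
    rw [← re_intervalIntegral (hw _ _), h1, Complex.zero_re]
  · rw [Complex.neg_im, im_intervalIntegral i1, im_intervalIntegral i2]
    simp only [Complex.im_ofReal_mul, im_intervalIntegral (hw _ _)]
    refine integral_mul_eq_neg_integral_deriv_mul_real hg him ?_
    rw [← im_intervalIntegral (hw _ _), h1, Complex.zero_im]

/-- `G 0, …, G β` are successive derivatives on `[0, 1]`, all but the last absolutely continuous. -/
structure DerivChain (β : ℕ) (G : ℕ → ℝ → ℝ) : Prop where
  ac : ∀ i < β, AbsolutelyContinuousOnInterval (G i) 0 1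
  deriv : ∀ i < β, G (i + 1) = derivWithin (G i) (Set.Icc 0 1)
  int : IntervalIntegrable (G β) volume 0 1

theorem DerivChain.tail {β : ℕ} {G : ℕ → ℝ → ℝ} (h : DerivChain (β + 1) G) :
    DerivChain β fun i => G (i + 1) :=
  ⟨fun i hi => h.ac (i + 1) (by omega), fun i hi => h.deriv (i + 1) (by omega), h.int⟩

theorem DerivChain.intervalIntegrable_zero {β : ℕ} {G : ℕ → ℝ → ℝ} (h : DerivChain β G) :
    IntervalIntegrable (G 0) volume 0 1 := by
  rcases Nat.eq_zero_or_pos β with rfl | hβ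
  · exact h.int
  · exact (h.ac 0 hβ).continuousOn.intervalIntegrable

theorem norm_integral_ofReal_mul_le {g : ℝ → ℝ} (hg : IntervalIntegrable g volume 0 1) {w : ℝ → ℂ}
    {C : ℝ} (hC : ∀ x ∈ Set.Icc (0 : ℝ) 1, ‖w x‖ ≤ C) :
    ‖∫ x in (0 : ℝ)..1, (g x : ℂ) * w x‖ ≤ C * ∫ x in (0 : ℝ)..1, |g x| := by
  rw [← intervalIntegral.integral_const_mul]
  refine norm_integral_le_of_norm_le zero_le_one ?_ (hg.abs.const_mul C)
  refine Filter.Eventually.of_forall fun x hx => ?_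
  rw [norm_mul, Complex.norm_real, Real.norm_eq_abs, mul_comm]
  exact mul_le_mul_of_nonneg_right (hC x ⟨hx.1.le, hx.2⟩) (abs_nonneg _)

/-- The weighted sum of the mean values of the derivatives and of the `L¹` norm of the last. -/
noncomputable def derivBound (m T₁ T₂ : ℝ) (β : ℕ) (G : ℕ → ℝ → ℝ) : ℝ :=
  (∑ i ∈ Finset.range (β + 1), T₁ / m ^ i * |∫ x in (0 : ℝ)..1, G i x|) +
    T₂ / m ^ β * ∫ x in (0 : ℝ)..1, |G β x|

theorem derivBound_succ {m T₁ T₂ : ℝ} {β : ℕ} {G : ℕ → ℝ → ℝ} :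
    derivBound m T₁ T₂ (β + 1) G =
      T₁ * |∫ x in (0 : ℝ)..1, G 0 x| + derivBound m T₁ T₂ β (fun i => G (i + 1)) / m := by
  unfold derivBound
  rw [Finset.sum_range_succ', add_div, Finset.sum_div]
  have : ∀ i ∈ Finset.range (β + 1), T₁ / m ^ (i + 1) * |∫ x in (0 : ℝ)..1, G (i + 1) x| =
      T₁ / m ^ i * |∫ x in (0 : ℝ)..1, G (i + 1) x| / m := fun i _ => by
    rw [pow_succ]; ring
  rw [Finset.sum_congr rfl this, pow_succ]
  ring

theorem integral_abs_nonneg (g : ℝ → ℝ) : 0 ≤ ∫ x in (0 : ℝ)..1, |g x| :=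
  integral_nonneg zero_le_one fun _ _ => abs_nonneg _

theorem derivBound_mul (c m T₁ T₂ : ℝ) (β : ℕ) (G : ℕ → ℝ → ℝ) :
    derivBound m (c * T₁) (c * T₂) β G = c * derivBound m T₁ T₂ β G := by
  unfold derivBound
  rw [mul_add, Finset.mul_sum]
  congr 1
  · exact Finset.sum_congr rfl fun i _ => by ring
  · ring

theorem derivBound_mono {m T₁ T₂ T₂' : ℝ} (hm : 0 ≤ m) (h : T₂ ≤ T₂') (β : ℕ) (G : ℕ → ℝ → ℝ) :
    derivBound m T₁ T₂ β G ≤ derivBound m T₁ T₂' β G := by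
  unfold derivBound
  have := integral_abs_nonneg (G β)
  gcongr

/-- This handles the derivatives left after all digits are used. The primitive of `φ - I` vanishes
at `0` and oscillates by at most `C / 2 ≤ C / m`, which bounds both its mean and its deviation from
the mean, so the hypotheses recur with `C / m`. -/
theorem norm_integral_mul_le_derivBound {m : ℝ} (hm : 0 < m) (hm2 : m ≤ 2) (β : ℕ) :
    ∀ {G : ℕ → ℝ → ℝ} {φ : ℝ → ℂ} {C : ℝ}, DerivChain β G → Continuous φ → 0 ≤ C →
      ‖∫ t in (0 : ℝ)..1, φ t‖ ≤ C →
      (∀ x ∈ Set.Icc (0 : ℝ) 1, ‖φ x - ∫ t in (0 : ℝ)..1, φ t‖ ≤ C) →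
      ‖∫ x in (0 : ℝ)..1, (G 0 x : ℂ) * φ x‖ ≤ derivBound m C C β G := by
  induction β with
  | zero =>
    intro G φ C hG hφ hC hI hD
    have e : ∫ x in (0 : ℝ)..1, (G 0 x : ℂ) * φ x =
        (∫ x in (0 : ℝ)..1, (G 0 x : ℂ)) * (∫ t in (0 : ℝ)..1, φ t) +
        ∫ x in (0 : ℝ)..1, (G 0 x : ℂ) * (φ x - ∫ t in (0 : ℝ)..1, φ t) := by
      rw [← intervalIntegral.integral_mul_const, ← intervalIntegral.integral_add
        ((intervalIntegrable_ofReal hG.int).mul_const _) ((intervalIntegrable_ofReal hG.int).mul_continuousOn (by fun_prop))]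
      exact integral_congr fun x _ => by ring
    rw [e]
    refine (norm_add_le _ _).trans ?_
    have b1 := norm_integral_ofReal_mul_le hG.int hD
    rw [norm_mul, intervalIntegral.integral_ofReal, Complex.norm_real, Real.norm_eq_abs]
    simp only [derivBound, zero_add, Finset.sum_range_one, pow_zero, div_one]
    have := mul_le_mul_of_nonneg_left hI (abs_nonneg (∫ x in (0 : ℝ)..1, G 0 x))
    linarith
  | succ β ih =>
    intro G φ C hG hφ hC hI hD
    set I := ∫ t in (0 : ℝ)..1, φ t with hIdef
    have hc : Continuous fun x => φ x - I := hφ.sub continuous_const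
    have h0 : ∫ t in (0 : ℝ)..1, (φ t - I) = 0 := by
      rw [intervalIntegral.integral_sub (hφ.intervalIntegrable _ _) (by simp)]
      simp [hIdef]
    have hci : ∀ a c, IntervalIntegrable (fun x => φ x - I) volume a c :=
      fun a c => hc.intervalIntegrable a c
    have hG0 := hG.intervalIntegrable_zero
    have e : ∫ x in (0 : ℝ)..1, (G 0 x : ℂ) * φ x =
        (∫ x in (0 : ℝ)..1, (G 0 x : ℂ)) * I +
        -∫ x in (0 : ℝ)..1, (G 1 x : ℂ) * ∫ t in (0 : ℝ)..x, (φ t - I) := by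
      rw [hG.deriv 0 (by omega), ← integral_mul_eq_neg_integral_derivWithin_mul
        (hG.ac 0 (by omega)) hci h0, ← intervalIntegral.integral_mul_const,
        ← intervalIntegral.integral_add
        ((intervalIntegrable_ofReal hG0).mul_const _) ((intervalIntegrable_ofReal hG0).mul_continuousOn (by fun_prop))]
      exact integral_congr fun x _ => by ring
    have hN : (∫ t in (0 : ℝ)..1, ‖φ t - I‖) ≤ C := by
      have := integral_mono_on (μ := volume) zero_le_one (hc.norm.intervalIntegrable 0 1)
        (intervalIntegrable_const (c := C)) hD
      simpa using this
    have hW : Continuous fun x => ∫ t in (0 : ℝ)..x, (φ t - I) := continuous_primitive hci 0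
    have hCm : C / 2 ≤ C / m := by gcongr
    have hdiff : ∀ x ∈ Set.Icc (0 : ℝ) 1, ∀ y ∈ Set.Icc (0 : ℝ) 1,
        ‖(∫ t in (0 : ℝ)..x, (φ t - I)) - ∫ t in (0 : ℝ)..y, (φ t - I)‖ ≤ C / m := by
      intro x hx y hy
      rw [integral_interval_sub_left (hci _ _) (hci _ _)]
      rcases le_total y x with h | h
      · have := norm_integral_le_half hc h0 hy.1 h hx.2
        linarith
      · rw [integral_symm, norm_neg]
        have := norm_integral_le_half hc h0 hx.1 h hy.2
        linarith
    have key := ih (φ := fun x => ∫ t in (0 : ℝ)..x, (φ t - I)) (C := C / m) hG.tail hW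
      (by positivity) ?_ ?_
    · rw [e, derivBound_succ]
      refine (norm_add_le _ _).trans ?_
      rw [norm_neg, norm_mul, intervalIntegral.integral_ofReal, Complex.norm_real,
        Real.norm_eq_abs, mul_comm]
      have e2 := derivBound_mul (1 / m) m C C β fun i => G (i + 1)
      rw [one_div_mul_eq_div, one_div_mul_eq_div] at e2
      rw [← e2]
      gcongr
    · have := norm_integral_le_of_norm_le_const (a := 0) (b := 1) (C := C / m)
        (f := fun x => ∫ t in (0 : ℝ)..x, (φ t - I)) fun x hx => by
          rw [Set.uIoc_of_le zero_le_one] at hx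
          simpa using hdiff x ⟨hx.1.le, hx.2⟩ 0 (by simp)
      simpa using this
    · intro x hx
      have e3 : (∫ t in (0 : ℝ)..x, (φ t - I)) - ∫ y in (0 : ℝ)..1, ∫ t in (0 : ℝ)..y, (φ t - I) =
          ∫ y in (0 : ℝ)..1, ((∫ t in (0 : ℝ)..x, (φ t - I)) - ∫ t in (0 : ℝ)..y, (φ t - I)) := by
        rw [intervalIntegral.integral_sub (by simp) (hW.intervalIntegrable _ _)]
        simp
      rw [e3]
      have := norm_integral_le_of_norm_le_const (a := 0) (b := 1) (C := C / m)
        (f := fun y => (∫ t in (0 : ℝ)..x, (φ t - I)) - ∫ t in (0 : ℝ)..y, (φ t - I)) fun y hy => by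
          rw [Set.uIoc_of_le zero_le_one] at hy
          exact hdiff x hx y ⟨hy.1.le, hy.2⟩
      simpa using this

/-! ### Stripping digits off a Walsh function. -/

/-- Completed cells contribute nothing, since the primitive of `w` vanishes at their ends; on the
current cell `u` is constant and factors out. -/
theorem integral_step_mul {u w : ℝ → ℂ} {P : ℝ} (hP : 0 < P)
    (hu : ∀ m : ℕ, ∀ x ∈ Set.Ico (m * P) ((m + 1) * P), u x = u (m * P))
    (hw : ∀ a c, IntervalIntegrable w volume a c)
    (huw : ∀ a c, IntervalIntegrable (fun t => u t * w t) volume a c)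
    (h0 : ∀ m : ℕ, ∫ t in (0 : ℝ)..(m * P), w t = 0) {x : ℝ} (hx : 0 ≤ x) :
    ∫ t in (0 : ℝ)..x, u t * w t = u x * ∫ t in (0 : ℝ)..x, w t := by
  have cell : ∀ m : ℕ, ∀ y, m * P ≤ y → y ≤ (m + 1) * P →
      ∫ t in (m * P)..y, u t * w t = u (m * P) * ∫ t in (0 : ℝ)..y, w t := by
    intro m y h1 h2
    rw [← integral_add_adjacent_intervals (hw 0 (m * P)) (hw (m * P) y), h0, zero_add,
      ← intervalIntegral.integral_const_mul, integral_of_le h1, integral_of_le h1,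
      ← integral_Ico_eq_integral_Ioc, ← integral_Ico_eq_integral_Ioc]
    exact setIntegral_congr_fun measurableSet_Ico fun t ht => by
      simp only [hu m t ⟨ht.1, ht.2.trans_le h2⟩]
  have zero : ∀ m : ℕ, ∫ t in (0 : ℝ)..(m * P), u t * w t = 0 := by
    intro m
    induction m with
    | zero => simp
    | succ m ih =>
      have h1 := cell m ((m + 1 : ℕ) * P) (by gcongr; simp) (by push_cast; exact le_rfl)
      rw [← integral_add_adjacent_intervals (huw 0 (m * P)) (huw (m * P) _), ih, h1, h0]
      simp
  have f1 : (⌊x / P⌋₊ : ℝ) * P ≤ x := by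
    rw [← le_div_iff₀ hP]; exact Nat.floor_le (by positivity)
  have f2 : x < (⌊x / P⌋₊ + 1) * P := by
    rw [← div_lt_iff₀ hP]; exact Nat.lt_floor_add_one _
  rw [← integral_add_adjacent_intervals (huw 0 _) (huw (⌊x / P⌋₊ * P) x), zero,
    cell _ x f1 f2.le, hu _ x ⟨f1, f2⟩, zero_add]

/-- The product over `j < n` of the `b`-adic step functions with digit frequencies `κ j`. -/
noncomputable def digitWave (b : ℕ) (z : ℂ) (κ : ℕ → ℕ) (n : ℕ) (x : ℝ) : ℂ :=
  ∏ j ∈ Finset.range n, (z ^ κ j) ^ ⌊x / ((b : ℝ) ^ (j + 1))⁻¹⌋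

theorem norm_digitWave {b : ℕ} {z : ℂ} (hz : ‖z‖ = 1) (κ : ℕ → ℕ) (n : ℕ) (x : ℝ) :
    ‖digitWave b z κ n x‖ = 1 := by
  simp [digitWave, hz]

theorem measurable_digitWave (b : ℕ) (z : ℂ) (κ : ℕ → ℕ) (n : ℕ) :
    Measurable (digitWave b z κ n) :=
  Finset.measurable_fun_prod _ fun _ _ => measurable_zpow_floor _ _

theorem digitWave_succ (b : ℕ) (z : ℂ) (κ : ℕ → ℕ) (n : ℕ) (x : ℝ) :
    digitWave b z κ (n + 1) x =
      digitWave b z κ n x * (z ^ κ n) ^ ⌊x / ((b : ℝ) ^ (n + 1))⁻¹⌋ :=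
  Finset.prod_range_succ _ _

theorem digitWave_eq_of_mem {b : ℕ} (hb : 0 < b) (z : ℂ) (κ : ℕ → ℕ) (n m : ℕ) {x : ℝ}
    (hx : x ∈ Set.Ico (m * ((b : ℝ) ^ n)⁻¹) ((m + 1) * ((b : ℝ) ^ n)⁻¹)) :
    digitWave b z κ n x = digitWave b z κ n (m * ((b : ℝ) ^ n)⁻¹) := by
  have hbR : (0 : ℝ) < b := by positivity
  refine Finset.prod_congr rfl fun j hj => ?_
  have hj' : j + 1 ≤ n := Finset.mem_range.1 hj
  -- Every coarser floor is an integer quotient of the finest one, `⌊y * b ^ n⌋`.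
  have key : ∀ y : ℝ, ⌊y / ((b : ℝ) ^ (j + 1))⁻¹⌋ =
      ⌊y * (b : ℝ) ^ n⌋ / ((b ^ (n - (j + 1)) : ℕ) : ℤ) := fun y => by
    rw [← Int.floor_div_natCast]
    congr 1
    have : (b : ℝ) ^ n = b ^ (n - (j + 1)) * b ^ (j + 1) := by
      rw [← pow_add, Nat.sub_add_cancel hj']
    rw [this]
    push_cast
    field_simp
  have hpow : (0 : ℝ) < (b : ℝ) ^ n := by positivity
  have e1 : ⌊x * (b : ℝ) ^ n⌋ = m := by
    rw [Int.floor_eq_iff]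
    have h1 := hx.1
    have h2 := hx.2
    rw [← div_eq_mul_inv, div_le_iff₀ hpow] at h1
    rw [← div_eq_mul_inv, lt_div_iff₀ hpow] at h2
    exact ⟨by exact_mod_cast h1, by exact_mod_cast h2⟩
  have e2 : ⌊(m : ℝ) * ((b : ℝ) ^ n)⁻¹ * (b : ℝ) ^ n⌋ = m := by
    rw [inv_mul_cancel_right₀ hpow.ne']; simp
  rw [key, key, e1, e2]

theorem stepPrimitive_nat_mul_eq_zero {φ : ℝ → ℂ} (hφ : Continuous φ) {ω : ℂ} (hω : ‖ω‖ = 1)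
    (hω1 : ω ≠ 1) {b : ℕ} (hωb : ω ^ b = 1) {h : ℝ} (hh : 0 < h) (hp : Function.Periodic φ h)
    (m : ℕ) : stepPrimitive ω h φ (m * (b * h)) = 0 := by
  have hh' : (h : ℂ) ≠ 0 := by exact_mod_cast hh.ne'
  have hs := stepPrimitive_sub_add hφ hω hω1 hh hp
    (I := (∫ t in (0 : ℝ)..h, φ t) / h) (by field_simp)
  have hper := periodic_of_add_eq_mul
    (g := fun x => stepPrimitive ω h φ x - h * ((∫ t in (0 : ℝ)..h, φ t) / h) / (1 - ω)) hs hωb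
  have := hper.nat_mul m 0
  simp only [zero_add, sub_left_inj] at this
  rw [this]
  simp [stepPrimitive]

theorem intervalIntegrable_digitWave_mul {b : ℕ} {z : ℂ} (hz : ‖z‖ = 1) (κ : ℕ → ℕ) (n : ℕ)
    {w : ℝ → ℂ} {a c : ℝ} (hw : IntervalIntegrable w volume a c) :
    IntervalIntegrable (fun t => digitWave b z κ n t * w t) volume a c := by
  rw [intervalIntegrable_iff] at hw ⊢
  exact hw.bdd_mul (c := 1) (measurable_digitWave b z κ n).aestronglyMeasurable
    (Filter.Eventually.of_forall fun x => (norm_digitWave hz κ n x).le)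

theorem integral_digitWave_succ {b : ℕ} (hb : 0 < b) {z : ℂ} (hzb : z ^ b = 1)
    (hz : ‖z‖ = 1) {κ : ℕ → ℕ} {n : ℕ} (hκ : z ^ κ n ≠ 1) {φ : ℝ → ℂ}
    (hφ : Continuous φ) (hp : Function.Periodic φ ((b : ℝ) ^ (n + 1))⁻¹)
    {x : ℝ} (hx : 0 ≤ x) :
    ∫ t in (0 : ℝ)..x, digitWave b z κ (n + 1) t * φ t =
      digitWave b z κ n x * stepPrimitive (z ^ κ n) ((b : ℝ) ^ (n + 1))⁻¹ φ x := by
  have hbR : (0 : ℝ) < b := by positivity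
  have hω : ‖z ^ κ n‖ = 1 := by simp [hz]
  have hωb : (z ^ κ n) ^ b = 1 := by rw [← pow_mul, mul_comm, pow_mul, hzb, one_pow]
  have hi := intervalIntegrable_zpow_floor_mul hφ hω ((b : ℝ) ^ (n + 1))⁻¹
  have hP : (b : ℝ) * ((b : ℝ) ^ (n + 1))⁻¹ = ((b : ℝ) ^ n)⁻¹ := by
    rw [pow_succ]; field_simp
  rw [stepPrimitive, ← integral_step_mul (P := ((b : ℝ) ^ n)⁻¹) (by positivity)
    (fun m y hy => digitWave_eq_of_mem hb z κ n m hy) hi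
    (fun a c => intervalIntegrable_digitWave_mul hz κ n (hi a c)) (fun m => ?_) hx]
  · exact integral_congr fun t _ => by simp only [digitWave_succ, mul_assoc]
  · have := stepPrimitive_nat_mul_eq_zero hφ hω hκ hωb (by positivity) hp m
    rwa [hP] at this

theorem integral_mul_digitWave_succ {b : ℕ} (hb : 0 < b) {z : ℂ} (hzb : z ^ b = 1)
    (hz : ‖z‖ = 1) {κ : ℕ → ℕ} {n : ℕ} (hκ : z ^ κ n ≠ 1) {φ : ℝ → ℂ}
    (hφ : Continuous φ) (hp : Function.Periodic φ ((b : ℝ) ^ (n + 1))⁻¹)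
    {g : ℝ → ℝ} (hg : AbsolutelyContinuousOnInterval g 0 1) :
    ∫ x in (0 : ℝ)..1, (g x : ℂ) * (digitWave b z κ (n + 1) x * φ x) =
      -∫ x in (0 : ℝ)..1, ((derivWithin g (Set.Icc 0 1) x : ℝ) : ℂ) *
        (digitWave b z κ n x * stepPrimitive (z ^ κ n) ((b : ℝ) ^ (n + 1))⁻¹ φ x) := by
  have hbR : (0 : ℝ) < b := by positivity
  have hω : ‖z ^ κ n‖ = 1 := by simp [hz]
  have hωb : (z ^ κ n) ^ b = 1 := by rw [← pow_mul, mul_comm, pow_mul, hzb, one_pow]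
  have hone : ((b ^ n : ℕ) : ℝ) * (b * ((b : ℝ) ^ (n + 1))⁻¹) = 1 := by
    push_cast; rw [pow_succ]; field_simp
  have hF : stepPrimitive (z ^ κ n) ((b : ℝ) ^ (n + 1))⁻¹ φ 1 = 0 := by
    rw [← hone]
    exact stepPrimitive_nat_mul_eq_zero hφ hω hκ hωb (by positivity) hp _
  rw [integral_mul_eq_neg_integral_derivWithin_mul hg
    (fun a c => intervalIntegrable_digitWave_mul hz κ (n + 1) (hφ.intervalIntegrable a c))
    (by rw [integral_digitWave_succ hb hzb hz hκ hφ hp zero_le_one, hF, mul_zero])]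
  congr 1
  refine integral_congr fun x hx => ?_
  rw [Set.uIcc_of_le zero_le_one] at hx
  simp only [integral_digitWave_succ hb hzb hz hκ hφ hp hx.1]

/-- The positions of the nonzero digits among `κ 0, …, κ (n - 1)`, in decreasing order. -/
def digitPositions (κ : ℕ → ℕ) (n : ℕ) : List ℕ :=
  ((List.range n).reverse.filter (fun j => κ j ≠ 0)).map (· + 1)

theorem digitPositions_succ (κ : ℕ → ℕ) (n : ℕ) :
    digitPositions κ (n + 1) =
      if κ n = 0 then digitPositions κ n else (n + 1) :: digitPositions κ n := by
  unfold digitPositions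
  rw [List.range_succ, List.reverse_concat, List.filter_cons]
  by_cases h : κ n = 0 <;> simp [h]

/-- Induction on the number of digits: a zero digit only lengthens the period, while a nonzero one
uses up a derivative and contributes its position to the exponent. -/
theorem norm_integral_digitWave_le {b : ℕ} (hb : 2 ≤ b) {T₁ T₂ : ℝ}
    {S : (ℝ → ℂ) → ℝ → ℝ → Prop} (hS : StepFamily b T₁ T₂ S) {z : ℂ} (hzb : z ^ b = 1)
    (hz : ‖z‖ = 1) {κ : ℕ → ℕ} (hκ : ∀ n, κ n ≠ 0 → z ^ κ n ≠ 1) (n : ℕ) :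
    ∀ {β : ℕ} {G : ℕ → ℝ → ℝ} {φ : ℝ → ℂ} {B : ℝ}, DerivChain β G → 0 ≤ B →
      S φ ((b : ℝ) ^ n)⁻¹ B →
      ‖∫ x in (0 : ℝ)..1, (G 0 x : ℂ) * (digitWave b z κ n x * φ x)‖ ≤
        ((b : ℝ) ^ ((digitPositions κ n).take β).sum)⁻¹ * B *
          derivBound (mConst b) T₁ T₂ β G := by
  have hbR : (0 : ℝ) < b := by positivity
  have hm := mConst_pos hb
  have hT₁ : 0 ≤ T₁ := zero_le_one.trans hS.one_le
  have hT₂ : 0 ≤ T₂ := hT₁.trans hS.le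
  induction n with
  | zero =>
    intro β G φ B hG hB hφ
    simp only [pow_zero, inv_one] at hφ
    have key := norm_integral_mul_le_derivBound hm (mConst_le_two b) β hG (hS.cont hφ)
      (by positivity) (hS.mean_le hB hφ) fun x _ => hS.dev_le hB hφ x
    have := key.trans (derivBound_mono hm.le (mul_le_mul_of_nonneg_right hS.le hB) β G)
    rw [mul_comm T₁, mul_comm T₂, derivBound_mul] at this
    simpa [digitWave, digitPositions] using this
  | succ n ih =>
    intro β G φ B hG hB hφ
    have hP : (b : ℝ) * ((b : ℝ) ^ (n + 1))⁻¹ = ((b : ℝ) ^ n)⁻¹ := by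
      rw [pow_succ]; field_simp
    rw [digitPositions_succ]
    split_ifs with h0
    · have h1 := hS.nat_mul (n := b) (by positivity) hB (by omega) hφ
      rw [hP] at h1
      simpa [digitWave_succ, h0] using ih hG hB h1
    -- With no derivative left, the remaining digits yield no decay and the sup norm bound `T₂ * B`
    -- is used.
    · rcases β with _ | β
      · have h1 := norm_integral_ofReal_mul_le hG.int (C := T₂ * B)
          (w := fun x => digitWave b z κ (n + 1) x * φ x) fun x _ => by
            rw [norm_mul, norm_digitWave hz, one_mul]
            exact hS.norm_le hB hφ x
        refine h1.trans ?_
        simp only [List.take_zero, List.sum_nil, pow_zero, inv_one, one_mul, derivBound, zero_add,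
          Finset.sum_range_one, div_one, mul_add]
        have : 0 ≤ B * (T₁ * |∫ x in (0 : ℝ)..1, G 0 x|) := by positivity
        linarith
      · have hω : ‖z ^ κ n‖ = 1 := by simp [hz]
        have hωb : (z ^ κ n) ^ b = 1 := by rw [← pow_mul, mul_comm, pow_mul, hzb, one_pow]
        have h1 := hS.step (h := ((b : ℝ) ^ (n + 1))⁻¹) (by positivity) hB hω (hκ n h0) hωb hφ
        rw [hP] at h1
        rw [integral_mul_digitWave_succ (by omega) hzb hz (hκ n h0) (hS.cont hφ) (hS.per hφ)
          (hG.ac 0 (by omega)), norm_neg, ← hG.deriv 0 (by omega)]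
        refine (ih hG.tail (div_nonneg (mul_nonneg (by positivity) hB) hm.le) h1).trans ?_
        rw [derivBound_succ, List.take_succ_cons, List.sum_cons, pow_add _ (n + 1), mul_inv]
        have e : ∀ p q D : ℝ, p * (q * B / mConst b) * D = q * p * B * (D / mConst b) :=
          fun p q D => by ring
        rw [e]
        have h2 : 0 ≤ T₁ * |∫ x in (0 : ℝ)..1, G 0 x| := mul_nonneg hT₁ (abs_nonneg _)
        gcongr
        linarith

/-! ### Hölder's inequality and the constant `C_{b,α,q}`. -/

theorem sum_add_le_Lp_mul_Lq (s t : Finset ℕ) (hst : s ⊆ t) {p q : ℝ} (hpq : p.HolderConjugate q)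
    (c A : ℕ → ℝ≥0∞) (c' N : ℝ≥0∞) :
    ∑ i ∈ s, c i * A i + c' * N ^ (1 / p) ≤
      (∑ i ∈ s, c i ^ q + c' ^ q) ^ (1 / q) * (∑ i ∈ t, A i ^ p + N) ^ (1 / p) := by
  -- The index `none` carries the extra term coming from the integral of the top derivative.
  have key := ENNReal.inner_le_Lp_mul_Lq (Finset.insertNone s)
    (fun o => o.elim c' c) (fun o => o.elim (N ^ (1 / p)) A) hpq.symm
  rw [Finset.sum_insertNone, Finset.sum_insertNone, Finset.sum_insertNone] at key
  simp only [Option.elim] at key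
  rw [← ENNReal.rpow_mul, one_div_mul_cancel hpq.ne_zero, ENNReal.rpow_one, add_comm,
    add_comm (c' ^ q), add_comm N] at key
  refine key.trans ?_
  have := hpq.pos
  gcongr

theorem lintegral_le_lintegral_rpow {Ω : Type*} [MeasurableSpace Ω] {μ : Measure Ω}
    [IsProbabilityMeasure μ] {g : Ω → ℝ≥0∞} (hg : AEMeasurable g μ) {p q : ℝ}
    (hpq : p.HolderConjugate q) : ∫⁻ x, g x ∂μ ≤ (∫⁻ x, g x ^ p ∂μ) ^ (1 / p) := by
  simpa using ENNReal.lintegral_mul_le_Lp_mul_Lq μ hpq hg (aemeasurable_const (b := 1))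

/-- The `ℓ^q` norm of the coefficients `T₁ / m, …, T₁ / m ^ α, T₂ / m ^ α`. -/
noncomputable def coeffNorm (m T₁ T₂ : ℝ) (α : ℕ) (q : ℝ≥0∞) : ℝ :=
  if q = ∞ then max (⨆ i : Finset.Icc 1 α, T₁ / m ^ (i : ℕ)) (T₂ / m ^ α)
  else (∑ i ∈ Finset.Icc 1 α, (T₁ / m ^ i) ^ q.toReal + (T₂ / m ^ α) ^ q.toReal) ^ (1 / q.toReal)

theorem boundConst_eq_coeffNorm_of_ne_two {b : ℕ} (hb : 3 ≤ b) (α : ℕ) (q : ℝ≥0∞) :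
    boundConst b α q = coeffNorm (mConst b) (1 + b * mConst b / (b - MConst b))
      (MConst b + b * mConst b / (b - MConst b)) α q := by
  have hm := mConst_pos (b := b) (by omega)
  have hS := stepFamily_nonDyadic hb
  have h1 := zero_le_one.trans hS.one_le
  have h2 := h1.trans hS.le
  have key : ∀ {T : ℝ}, 0 ≤ T → ∀ (i : ℕ) (r : ℝ),
      1 / mConst b ^ (i * r) * T ^ r = (T / mConst b ^ i) ^ r := fun hT i r => by
    rw [Real.div_rpow hT (by positivity), Real.rpow_mul hm.le, Real.rpow_natCast]
    ring
  rw [boundConst, if_neg (by omega), boundConstNonDyadic, coeffNorm]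
  split_ifs
  · simp only [one_div_mul_eq_div]
  · simp only [key h1, key h2]

theorem boundConst_two_eq_coeffNorm (α : ℕ) (q : ℝ≥0∞) :
    boundConst 2 α q = coeffNorm (mConst 2) 1 2 α q := by
  have e1 : ∀ i : ℕ, (2 : ℝ) ^ (-(i : ℝ)) = 1 / 2 ^ i := fun i => by
    rw [Real.rpow_neg two_pos.le, Real.rpow_natCast, one_div]
  have e2 : (2 : ℝ) ^ (-((α : ℝ) - 1)) = 2 / 2 ^ α := by
    rw [neg_sub, Real.rpow_sub two_pos, Real.rpow_natCast, Real.rpow_one]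
  rw [boundConst, if_pos rfl, boundConstDyadic, coeffNorm, mConst_two]
  simp only [← neg_mul, Real.rpow_mul two_pos.le, e1, e2]

theorem sum_add_le_coeffNorm_mul_sobNorm {m T₁ T₂ : ℝ} (hm : 0 < m) (h₁ : 0 ≤ T₁) (h₂ : 0 ≤ T₂)
    {α : ℕ} {p q : ℝ≥0∞} (hpq : p.HolderConjugate q) {f : ℝ → ℝ}
    (hf : AEStronglyMeasurable (der α f) (volume.restrict (Set.Icc 0 1))) :
    ∑ i ∈ Finset.Icc 1 α, ENNReal.ofReal (T₁ / m ^ i) * ‖∫ x in (0 : ℝ)..1, der i f x‖ₑ +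
        ENNReal.ofReal (T₂ / m ^ α) * ∫⁻ x in Set.Icc (0 : ℝ) 1, ‖der α f x‖ₑ ≤
      ENNReal.ofReal (coeffNorm m T₁ T₂ α q) * sobNorm p α f := by
  have hsub : Finset.Icc 1 α ⊆ Finset.range (α + 1) := fun i hi => by
    simp only [Finset.mem_Icc, Finset.mem_range] at hi ⊢; omega
  have hprob : IsProbabilityMeasure (volume.restrict (Set.Icc (0 : ℝ) 1)) := ⟨by simp⟩
  have hc : ∀ i : ℕ, 0 ≤ T₁ / m ^ i := fun i => by positivity
  have hc' : 0 ≤ T₂ / m ^ α := by positivity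
  by_cases hp : p = ∞
  · subst hp
    have hq : q = 1 := by
      have := hpq.inv_add_inv_eq_inv
      simpa using this
    subst hq
    rw [coeffNorm, if_neg ENNReal.one_ne_top, sobNorm, if_pos rfl]
    simp only [ENNReal.toReal_one, Real.rpow_one, div_one]
    rw [ENNReal.ofReal_add (Finset.sum_nonneg fun i _ => hc i) hc',
      ENNReal.ofReal_sum_of_nonneg fun i _ => hc i, add_mul, Finset.sum_mul]
    gcongr with i hi
    · exact (Finset.le_sup (f := fun i => ‖∫ x in (0 : ℝ)..1, der i f x‖ₑ) (hsub hi)).trans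
        (le_max_left _ _)
    · refine le_trans ?_ (le_max_right _ _)
      have := lintegral_mono_ae (ENNReal.ae_le_essSup (μ := volume.restrict (Set.Icc (0 : ℝ) 1))
        fun x => ‖der α f x‖ₑ)
      simpa using this
  by_cases hq : q = ∞
  · subst hq
    have hp : p = 1 := by
      have := hpq.inv_add_inv_eq_inv
      simpa using this
    subst hp
    rw [coeffNorm, if_pos rfl, sobNorm, if_neg ENNReal.one_ne_top]
    simp only [ENNReal.toReal_one, ENNReal.rpow_one, div_one]
    rw [mul_add, Finset.mul_sum]
    refine add_le_add ?_ ?_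
    · refine (Finset.sum_le_sum fun i hi => ?_).trans (Finset.sum_le_sum_of_subset hsub)
      gcongr
      exact le_max_of_le_left (le_ciSup (f := fun i : Finset.Icc 1 α => T₁ / m ^ (i : ℕ))
        (Set.finite_range _).bddAbove ⟨i, hi⟩)
    · gcongr
      exact le_max_right _ _
  · have hpq' := ENNReal.HolderConjugate.toReal_of_ne_top (p := p) (q := q) hp hq
    rw [coeffNorm, if_neg hq, sobNorm, if_neg hp]
    have hq0 := hpq'.symm.nonneg
    rw [← ENNReal.ofReal_rpow_of_nonneg (add_nonneg (Finset.sum_nonneg fun i _ =>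
      Real.rpow_nonneg (hc i) _) (Real.rpow_nonneg hc' _)) (by positivity),
      ENNReal.ofReal_add (Finset.sum_nonneg fun i _ => Real.rpow_nonneg (hc i) _)
        (Real.rpow_nonneg hc' _),
      ENNReal.ofReal_sum_of_nonneg fun i _ => Real.rpow_nonneg (hc i) _,
      ← ENNReal.ofReal_rpow_of_nonneg hc' hq0]
    simp only [← ENNReal.ofReal_rpow_of_nonneg (hc _) hq0]
    refine le_trans ?_ (sum_add_le_Lp_mul_Lq _ _ hsub hpq' _ _ _ _)
    gcongr
    exact lintegral_le_lintegral_rpow hf.enorm hpq'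

/-! ### From the Sobolev space and Walsh coefficients to the final bound. -/

theorem derivChain_of_mem_Sob {α : ℕ} (hα : 0 < α) {f : ℝ → ℝ} (hf : f ∈ Sob α) :
    DerivChain α fun i => der i f := by
  have hd : ∀ i, der (i + 1) f = derivWithin (der i f) (Set.Icc 0 1) :=
    fun i => iteratedDerivWithin_succ
  refine ⟨hf.2.1, fun i _ => hd i, ?_⟩
  obtain ⟨β, rfl⟩ := Nat.exists_eq_add_of_le' hα
  rw [hd β]
  exact intervalIntegrable_derivWithin (hf.2.1 β (by omega))

theorem ofReal_derivBound_tail {m T₁ T₂ : ℝ} (hm : 0 < m) (h₁ : 0 ≤ T₁) (h₂ : 0 ≤ T₂)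
    {β : ℕ} {G : ℕ → ℝ → ℝ} (hG : IntervalIntegrable (G (β + 1)) volume 0 1) :
    ENNReal.ofReal (derivBound m T₁ T₂ β (fun i => G (i + 1)) / m) =
      ∑ i ∈ Finset.Icc 1 (β + 1), ENNReal.ofReal (T₁ / m ^ i) * ‖∫ x in (0 : ℝ)..1, G i x‖ₑ +
        ENNReal.ofReal (T₂ / m ^ (β + 1)) * ∫⁻ x in Set.Icc (0 : ℝ) 1, ‖G (β + 1) x‖ₑ := by
  have e : derivBound m T₁ T₂ β (fun i => G (i + 1)) / m =
      ∑ i ∈ Finset.Icc 1 (β + 1), T₁ / m ^ i * ‖∫ x in (0 : ℝ)..1, G i x‖ +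
        T₂ / m ^ (β + 1) * ∫ x in (0 : ℝ)..1, ‖G (β + 1) x‖ := by
    have hI : Finset.Icc 1 (β + 1) = Finset.Ico (0 + 1) (β + 1 + 1) := by
      ext i; simp only [Finset.mem_Icc, Finset.mem_Ico]; omega
    rw [derivBound, add_div, Finset.sum_div, Finset.range_eq_Ico, hI, ← Finset.sum_Ico_add']
    congr 1
    · exact Finset.sum_congr rfl fun i _ => by rw [pow_succ, Real.norm_eq_abs]; ring
    · simp only [Real.norm_eq_abs]
      rw [pow_succ]
      ring
  have hint : ∫⁻ x in Set.Icc (0 : ℝ) 1, ‖G (β + 1) x‖ₑ =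
      ENNReal.ofReal (∫ x in (0 : ℝ)..1, ‖G (β + 1) x‖) := by
    rw [integral_of_le zero_le_one, ofReal_integral_norm_eq_lintegral_enorm hG.1]
    exact setLIntegral_congr Ioc_ae_eq_Icc.symm
  rw [e, hint, ENNReal.ofReal_add (Finset.sum_nonneg fun i _ => by positivity)
    (mul_nonneg (by positivity) (integral_nonneg zero_le_one fun _ _ => norm_nonneg _)),
    ENNReal.ofReal_sum_of_nonneg fun i _ => by positivity, ENNReal.ofReal_mul (by positivity)]
  simp only [ENNReal.ofReal_mul (div_nonneg h₁ (pow_nonneg hm.le _)), ofReal_norm]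

/-- Digits are floors modulo `b`, and the reduction is invisible because `z ^ b = 1`. -/
theorem conj_wal_eq_digitWave {b : ℕ} [NeZero b] (k : ℕ) {x : ℝ} (hx : 0 ≤ x) {z : ℂ}
    (hz : z = (starRingEnd ℂ) (Complex.exp (2 * Real.pi * Complex.I / b))) (hzb : z ^ b = 1) :
    (starRingEnd ℂ) (wal b k x) =
      digitWave b z (natDigit b k) (Nat.digits b k).length x := by
  rw [wal, map_pow, ← hz, ← Finset.prod_pow_eq_pow_sum, digitWave]
  refine Finset.prod_congr rfl fun j _ => ?_
  rw [pow_mul, Real.digits, Fin.val_ofNat, div_inv_eq_mul,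
    ← Int.natCast_floor_eq_floor (by positivity), zpow_natCast]
  refine (pow_eq_pow_mod _ ?_).symm
  rw [← pow_mul, mul_comm, pow_mul, hzb, one_pow]

theorem walshCoeff_eq {b : ℕ} [NeZero b] (f : ℝ → ℝ) (k : ℕ) {z : ℂ}
    (hz : z = (starRingEnd ℂ) (Complex.exp (2 * Real.pi * Complex.I / b))) (hzb : z ^ b = 1) :
    walshCoeff b f k = ∫ x in (0 : ℝ)..1, (f x : ℂ) *
      (digitWave b z (natDigit b k) (Nat.digits b k).length x * 1) := by
  rw [walshCoeff, integral_of_le zero_le_one, ← integral_Ico_eq_integral_Ioc]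
  exact setIntegral_congr_fun measurableSet_Ico fun x hx => by
    simp only [conj_wal_eq_digitWave k hx.1 hz hzb, mul_one]

/-- The top digit is nonzero and is stripped separately, before the general estimate; this is why no
term in `∫ f` appears on the right. -/
theorem norm_walshCoeff_le {b : ℕ} [NeZero b] (hb : 2 ≤ b) {T₁ T₂ : ℝ}
    {S : (ℝ → ℂ) → ℝ → ℝ → Prop} (hS : StepFamily b T₁ T₂ S) {k : ℕ} (hk : 0 < k) {β : ℕ}
    {G : ℕ → ℝ → ℝ} (hG : DerivChain (β + 1) G) :
    ‖walshCoeff b (G 0) k‖ ≤ (b : ℝ) ^ (-(mu b (β + 1) k : ℤ)) *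
      (derivBound (mConst b) T₁ T₂ β (fun i => G (i + 1)) / mConst b) := by
  have hb0 : (b : ℂ) ≠ 0 := by exact_mod_cast (by omega : b ≠ 0)
  have hbR : (0 : ℝ) < b := by positivity
  have hm := mConst_pos hb
  have hprim := Complex.isPrimitiveRoot_exp b (by omega)
  obtain ⟨z, hz⟩ : ∃ z, z = (starRingEnd ℂ) (Complex.exp (2 * Real.pi * Complex.I / b)) := ⟨_, rfl⟩
  have hzp : IsPrimitiveRoot z b := by
    rw [hz]; exact hprim.map_of_injective (starRingEnd ℂ).injective
  have hzb := hzp.pow_eq_one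
  have hzn : ‖z‖ = 1 := hzp.norm'_eq_one (by omega)
  have hκ : ∀ n, natDigit b k n ≠ 0 → z ^ natDigit b k n ≠ 1 := fun n hn => by
    refine hzp.pow_ne_one_of_pos_of_lt hn ?_
    rw [natDigit, Nat.getD_digits _ _ hb]
    exact Nat.mod_lt _ (by omega)
  have hne : Nat.digits b k ≠ [] := Nat.digits_ne_nil_iff_ne_zero.2 hk.ne'
  obtain ⟨n, hn⟩ : ∃ n, (Nat.digits b k).length = n + 1 :=
    Nat.exists_eq_succ_of_ne_zero (by simpa using hne)
  have htop : natDigit b k n ≠ 0 := by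
    have := Nat.getLast_digit_ne_zero b hk.ne'
    rw [List.getLast_eq_getElem] at this
    rw [natDigit, List.getD_eq_getElem _ _ (by omega)]
    simpa [hn] using this
  have hmu : mu b (β + 1) k = (n + 1) + ((digitPositions (natDigit b k) n).take β).sum := by
    have : positions b k = digitPositions (natDigit b k) (n + 1) := by
      rw [positions, hn]; rfl
    rw [mu, this, digitPositions_succ, if_neg htop, List.take_succ_cons, List.sum_cons]
  have hP : (b : ℝ) * ((b : ℝ) ^ (n + 1))⁻¹ = ((b : ℝ) ^ n)⁻¹ := by
    rw [pow_succ]; field_simp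
  have h0 := hS.one (P := ((b : ℝ) ^ (n + 1))⁻¹) (by positivity)
  have hωb : (z ^ natDigit b k n) ^ b = 1 := by rw [← pow_mul, mul_comm, pow_mul, hzb, one_pow]
  have h1 := hS.step (h := ((b : ℝ) ^ (n + 1))⁻¹) (by positivity) zero_le_one
    (by simp [hzn]) (hκ n htop) hωb h0
  rw [hP] at h1
  rw [walshCoeff_eq _ k hz hzb, hn, integral_mul_digitWave_succ (φ := fun _ => 1) (by omega) hzb hzn
    (hκ n htop) (hS.cont h0) (hS.per h0) (hG.ac 0 (by omega)), norm_neg,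
    ← hG.deriv 0 (by omega), hmu]
  refine (norm_integral_digitWave_le hb hS hzb hzn hκ n hG.tail (by positivity) h1).trans
    (le_of_eq ?_)
  rw [zpow_neg, zpow_natCast, pow_add _ (n + 1), mul_inv]
  ring

theorem enorm_walshCoeff_le {b : ℕ} [NeZero b] (hb : 2 ≤ b) {T₁ T₂ : ℝ}
    {S : (ℝ → ℂ) → ℝ → ℝ → Prop} (hS : StepFamily b T₁ T₂ S) {α k : ℕ} (hα : 0 < α) (hk : 0 < k)
    {p q : ℝ≥0∞} (hpq : p.HolderConjugate q) {f : ℝ → ℝ} (hf : f ∈ Sob α) :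
    ‖walshCoeff b f k‖ₑ ≤ ENNReal.ofReal ((b : ℝ) ^ (-(mu b α k : ℤ)) *
      coeffNorm (mConst b) T₁ T₂ α q) * sobNorm p α f := by
  have hm := mConst_pos hb
  have hT₁ : 0 ≤ T₁ := zero_le_one.trans hS.one_le
  have hT₂ : 0 ≤ T₂ := hT₁.trans hS.le
  have hG := derivChain_of_mem_Sob hα hf
  have hmeas := hf.2.2.1
  obtain ⟨β, rfl⟩ := Nat.exists_eq_add_of_le' hα
  have h1 := norm_walshCoeff_le (G := fun i => der i f) hb hS hk hG
  have h0 : der 0 f = f := iteratedDerivWithin_zero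
  simp only [h0] at h1
  rw [← ofReal_norm, ENNReal.ofReal_mul (by positivity), mul_assoc]
  refine (ENNReal.ofReal_le_ofReal h1).trans ?_
  rw [ENNReal.ofReal_mul (by positivity)]
  refine mul_le_mul' le_rfl ?_
  exact (ofReal_derivBound_tail (G := fun i => der i f) hm hT₁ hT₂ hG.int).trans_le
    (sum_add_le_coeffNorm_mul_sobNorm hm hT₁ hT₂ hpq hmeas)

end WalshSobolev

theorem mainTheorem6 (b : ℕ) [NeZero b] (hb : 2 ≤ b) (α k : ℕ) (hα : 0 < α) (hk : 0 < k)
    (p q : ENNReal) (hpq : p.HolderConjugate q) (f : ℝ → ℝ) (hf : f ∈ WalshSobolev.Sob α) :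
    ‖WalshSobolev.walshCoeff b f k‖ₑ ≤
      ENNReal.ofReal
          ((b : ℝ) ^ (-(WalshSobolev.mu b α k : ℤ)) * WalshSobolev.boundConst b α q) *
        WalshSobolev.sobNorm p α f := by
  rcases eq_or_lt_of_le hb with rfl | hb3
  · rw [WalshSobolev.boundConst_two_eq_coeffNorm]
    exact WalshSobolev.enorm_walshCoeff_le hb WalshSobolev.stepFamily_dyadic hα hk hpq hf
  · rw [WalshSobolev.boundConst_eq_coeffNorm_of_ne_two hb3]
    exact WalshSobolev.enorm_walshCoeff_le hb (WalshSobolev.stepFamily_nonDyadic hb3) hα hk hpq hf
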